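/- For a positive integer $n$, a symmetric real $n\times n$ matrix $M$ with zero diagonal and $\theta\in\mathbb{R}^n$, let $I_{(M,\theta)}$ be the Ising model, i.e. the probability distribution on $\{-1,1\}^n$ with $\mathbb{P}[X=x]\propto \exp(\theta\cdot x+\tfrac12\, x\cdot Mx)$. For $S\subseteq[n]$ let $\overline I_{S,(M,\theta)}$ be the censored Markov random field with visible vertices $S$, i.e. the distribution on $\{-1,1\}^S$ of $X_S=(X_i)_{i\in S}$ for $X\sim I_{(M,\theta)}$. For probability distributions $P,Q$ on $\{-1,1\}^S$ let $$W(P,Q)=\inf_\mu \mathbb{E}_{(x,y)\sim\mu}\,\#\{i\in S: x_i\neq y_i\}$$ be the earth-mover distance, the infimum being over all couplings $\mu$ of $P$ and $Q$. Let $A$ be a randomized algorithm that is given $n$ and draws on a sequence of samples $x=(x_1,x_2,\dots)$ from $\{-1,1\}^S$ (each presented as a list of $n$ symbols in which the entries of the vertices outside $S$ are marked as censored), and that outputs an element of $\{-1,1\}^S$. Write $P(A,x)$ for the distribution of its output over its internal coin flips when the samples $x$ are fixed, and for a distribution $Q$ on $\{-1,1\}^S$ put $$W_Q(A,Q)=\mathbb{E}_{x\sim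 Q^{\infty}}\big[W(Q,P(A,x))\big].$$ **Theorem.** Let $\epsilon,b,d>0$ be real numbers such that $bd<1/2$. There exist constants $c,C>0$ and an algorithm $A'$, depending only on $\epsilon,b,d$, such that the following holds for every $n>0$, every $S\subseteq[n]$, every $\theta\in[-b,b]^n$ and every symmetric $n\times n$ real matrix $M$ such that $M_{i,i}=0$ for all $i$, $|M_{i,j}|\le b$ for all $i,j$, and for each $i$ there are at most $d$ values of $j$ with $M_{i,j}\neq 0$. The algorithm $A'$ runs in $O(n^c)$ time (on every sequence of samples and for all outcomes of its coin flips, the implied constant depending only on $\epsilon,b,d$), and $$W_{\overline I_{S,(M,\theta)}}\big(A',\overline I_{S,(M,\theta)}\big)\le \epsilon n+C .$$ Here an algorithm is a program for a random access machine over the natural numbers, with addition and truncated subtraction as its arithmetic, each of whose steps (a command or a test, in particular one fair coin flip or the reading of one symbol of a sample) takes unit time. -/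

import Mathlib

open MeasureTheory
open scoped ENNReal Matrix

namespace CensoredIsing

/-! ### Ising models and censored Markov random fields -/

section Models

/-- A spin is a `Bool`; its numerical value is `1` or `-1`. -/
def spin (s : Bool) : ℝ := if s then 1 else -1

/-- The unnormalised weight `exp (θ · x + ½ x · M x)` of a configuration. -/
noncomputable def isingWeight {n : ℕ} (M : Matrix (Fin n) (Fin n) ℝ) (θ : Fin n → ℝ)
    (x : Fin n → Bool) : ℝ :=
  Real.exp (θ ⬝ᵥ (fun i => spin (x i)) +
    1 / 2 * ((fun i => spin (x i)) ⬝ᵥ (M *ᵥ (fun i => spin (x i)))))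

/-- The partition function. -/
noncomputable def partitionFunction {n : ℕ} (M : Matrix (Fin n) (Fin n) ℝ)
    (θ : Fin n → ℝ) : ℝ :=
  ∑ y : Fin n → Bool, isingWeight M θ y

theorem partitionFunction_pos {n : ℕ} (M : Matrix (Fin n) (Fin n) ℝ) (θ : Fin n → ℝ) :
    0 < partitionFunction M θ :=
  Finset.sum_pos (fun _ _ => Real.exp_pos _) Finset.univ_nonempty

theorem sum_ising {n : ℕ} (M : Matrix (Fin n) (Fin n) ℝ) (θ : Fin n → ℝ) :
    ∑ x : Fin n → Bool, ENNReal.ofReal (isingWeight M θ x / partitionFunction M θ) = 1 := by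
  have hZ := partitionFunction_pos M θ
  have hnn : ∀ x ∈ (Finset.univ : Finset (Fin n → Bool)),
      0 ≤ isingWeight M θ x / partitionFunction M θ :=
    fun x _ => div_nonneg (Real.exp_pos _).le hZ.le
  rw [← ENNReal.ofReal_sum_of_nonneg hnn, ← Finset.sum_div]
  change ENNReal.ofReal (partitionFunction M θ / partitionFunction M θ) = 1
  rw [div_self hZ.ne', ENNReal.ofReal_one]

/-- The Ising model with edge weights `M` and biases `θ`. -/
noncomputable def ising {n : ℕ} (M : Matrix (Fin n) (Fin n) ℝ) (θ : Fin n → ℝ) :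
    PMF (Fin n → Bool) :=
  PMF.ofFintype (fun x => ENNReal.ofReal (isingWeight M θ x / partitionFunction M θ))
    (sum_ising M θ)

/-- The censored Markov random field: the law of `(X i : i ∈ S)` for `X` drawn from the Ising
model. -/
noncomputable def cmrf {n : ℕ} (S : Finset (Fin n)) (M : Matrix (Fin n) (Fin n) ℝ)
    (θ : Fin n → ℝ) : PMF (S → Bool) :=
  (ising M θ).map (fun x i => x i)

/-- The earth-mover distance: the infimum over all couplings of the expected number of
coordinates that differ. -/
noncomputable def earthMover {ι α : Type*} [Fintype ι] [DecidableEq α] [MeasurableSpace α]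
    (P Q : Measure (ι → α)) : ℝ≥0∞ :=
  ⨅ (γ : Measure ((ι → α) × (ι → α))) (_ : γ.map Prod.fst = P) (_ : γ.map Prod.snd = Q),
    ∫⁻ p, (hammingDist p.1 p.2 : ℝ≥0∞) ∂γ

end Models

/-! ### The machine model

Algorithms are structured programs for a random access machine over the natural numbers, with
finitely many registers and arrays (those named in the program), a source of fair coins, and
a one-way read-only tape of samples. The arithmetic operations are addition and truncated
subtraction only, and every command and every test takes one unit of time. An expression has
a size fixed by the program, so charging its evaluation one unit changes running times by at
most a constant factor that depends on the program. As there is no multiplication, numbers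
have at most linearly many bits in the time elapsed (plus the input size), so polynomial time
here is polynomial time in the usual sense. -/

section Machine

/-- Arithmetic expressions. -/
inductive Arith : Type
  | const (k : ℕ) : Arith
  | reg (r : ℕ) : Arith
  /-- The entry of array `a` at a computed index. -/
  | get (a : ℕ) (index : Arith) : Arith
  | add (e₁ e₂ : Arith) : Arith
  /-- Truncated subtraction. -/
  | sub (e₁ e₂ : Arith) : Arith

/-- Programs. -/
inductive Prog : Type
  | skip : Prog
  /-- Register `r` receives the value of `e`. -/
  | assign (r : ℕ) (e : Arith) : Prog
  /-- The entry of array `a` at the first value receives the second value. -/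
  | store (a : ℕ) (index e : Arith) : Prog
  /-- Register `r` receives a fresh fair coin flip, `0` or `1`. -/
  | flip (r : ℕ) : Prog
  /-- Register `r` receives the next symbol of the sample tape. -/
  | read (r : ℕ) : Prog
  | seq (p q : Prog) : Prog
  /-- If `e₁ < e₂` then `p` else `q`. -/
  | cond (e₁ e₂ : Arith) (p q : Prog) : Prog
  /-- While `e₁ < e₂` do `p`. -/
  | loop (e₁ e₂ : Arith) (p : Prog) : Prog

/-- Memory contents and the positions on the coin tape and on the sample tape. -/
structure State : Type where
  reg : ℕ → ℕ
  arr : ℕ → ℕ → ℕ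
  coinPos : ℕ
  tapePos : ℕ

def Arith.eval (s : State) : Arith → ℕ
  | .const k => k
  | .reg r => s.reg r
  | .get a e => s.arr a (e.eval s)
  | .add e₁ e₂ => e₁.eval s + e₂.eval s
  | .sub e₁ e₂ => e₁.eval s - e₂.eval s

/-- The stack of programs that remain to be executed, and the state. The machine has halted
when the stack is empty. -/
abbrev Config : Type := List Prog × State

/-- One unit of time, for a given sample tape and given outcomes of the coin flips. -/
def step (tape : ℕ → ℕ) (coins : ℕ → Bool) : Config → Config
  | ([], s) => ([], s)
  | (.skip :: k, s) => (k, s)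
  | (.assign r e :: k, s) => (k, { s with reg := Function.update s.reg r (e.eval s) })
  | (.store a i e :: k, s) =>
      (k, { s with
            arr := Function.update s.arr a (Function.update (s.arr a) (i.eval s) (e.eval s)) })
  | (.flip r :: k, s) =>
      (k, { s with
            reg := Function.update s.reg r (if coins s.coinPos then 1 else 0)
            coinPos := s.coinPos + 1 })
  | (.read r :: k, s) =>
      (k, { s with
            reg := Function.update s.reg r (tape s.tapePos)
            tapePos := s.tapePos + 1 })
  | (.seq p q :: k, s) => (p :: q :: k, s)
  | (.cond e₁ e₂ p q :: k, s) => (if e₁.eval s < e₂.eval s then p :: k else q :: k, s)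
  | (.loop e₁ e₂ p :: k, s) =>
      (if e₁.eval s < e₂.eval s then p :: .loop e₁ e₂ p :: k else k, s)

end Machine

/-! ### Learning from samples of the visible vertices -/

section Learning

/-- The tape that lists the samples one after another, each as `n` symbols, one for each vertex
in order: `0` for a censored vertex, `1` for the spin `1`, and `2` for the spin `-1`. -/
def sampleTape {n : ℕ} (S : Finset (Fin n)) (x : ℕ → S → Bool) (k : ℕ) : ℕ :=
  if h : k % n < n then
    if hS : (⟨k % n, h⟩ : Fin n) ∈ S then
      if x (k / n) ⟨⟨k % n, h⟩, hS⟩ then 1 else 2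
    else 0
  else 0

/-- At the start register `0` holds `n` and all other registers and entries are `0`. -/
def initState (n : ℕ) : State where
  reg := Function.update 0 0 n
  arr := 0
  coinPos := 0
  tapePos := 0

/-- The configuration of program `A` after `t` units of time. -/
def configAt (A : Prog) {n : ℕ} (S : Finset (Fin n)) (x : ℕ → S → Bool) (coins : ℕ → Bool)
    (t : ℕ) : Config :=
  (step (sampleTape S x) coins)^[t] ([A], initState n)

/-- `A` halts within `T` units of time, on every sequence of samples from `{-1, 1} ^ S` and for
all outcomes of the coin flips. -/
def RunsInTime (A : Prog) {n : ℕ} (S : Finset (Fin n)) (T : ℕ) : Prop :=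
  ∀ (x : ℕ → S → Bool) (coins : ℕ → Bool), (configAt A S x coins T).1 = []

open Classical in
/-- The output of `A` when it halts: the spin of `i ∈ S` is `1` if entry `i` of array `0` is
`1`, and `-1` otherwise. (All spins are `-1` if `A` never halts.) -/
noncomputable def output (A : Prog) {n : ℕ} (S : Finset (Fin n)) (x : ℕ → S → Bool)
    (coins : ℕ → Bool) : S → Bool :=
  if h : ∃ t, (configAt A S x coins t).1 = [] then
    fun i => decide ((configAt A S x coins (Nat.find h)).2.arr 0 i.1 = 1)
  else fun _ => false

/-- Independent fair coin flips. -/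
noncomputable def fairCoins : Measure (ℕ → Bool) :=
  Measure.infinitePi (fun _ : ℕ => (PMF.uniformOfFintype Bool).toMeasure)

/-- The law of the output of `A`, over its coin flips, for a fixed sequence of samples. -/
noncomputable def outputLaw (A : Prog) {n : ℕ} (S : Finset (Fin n)) (x : ℕ → S → Bool) :
    Measure (S → Bool) :=
  fairCoins.map (output A S x)

/-- The expected earth-mover distance between `Q` and the law of the output of `A`, over
independent samples from `Q`. -/
noncomputable def learningError (A : Prog) {n : ℕ} (S : Finset (Fin n))
    (Q : PMF (S → Bool)) : ℝ≥0∞ :=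
  ∫⁻ x, earthMover Q.toMeasure (outputLaw A S x)
    ∂(Measure.infinitePi (fun _ : ℕ => Q.toMeasure))

end Learning

end CensoredIsing

/-! The algorithm draws the visible spins in order, each from an estimate of its conditional law
given the visible spins already drawn. Put `ρ = b * d`, a bound for the row sums of `|M|`.

Contraction. Dobrushin's comparison (`abs_sum_sub_sum_le`, `abs_condTrue_sub_le`) shows that
altering the conditioned spins on `D` moves the conditional probability at `i` by at most `∑ j ∈ D,
pathWeight M m i j + ρ ^ m`. Censored vertices are just not conditioned on. The row sums of these
weights are at most `ρ / (1 - ρ)`, which is below `1` because `ρ < 1 / 2`. So if the exact and the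
approximate sequential samplers are coupled maximally at each step, a uniform error `η` in the
conditional probabilities costs at most `η / (1 - ρ / (1 - ρ))` expected disagreement per vertex and
does not accumulate (`expect_seqCouple_ne_le`). By the chain rule the exact sampler produces the
censored field (`seqLaw_visProb_map`).

Localisation. Up to `ρ ^ m`, only a bounded number `r` of vertices with nonzero weight matter, and
conditioning on further visible ones does no harm. Events that fix boundedly many spins have
probability bounded below (`minProb_pow_le_mass`), so polynomially many samples determine such
conditional probabilities.

Finding the relevant vertices. They are unknown, so for a random threshold `u / 2 ^ L` two players
alternately name `2 * r` vertices, and the leaf asks whether the empirical conditional probability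
given the named visible vertices exceeds the threshold. Either player can name all relevant vertices
in `r` turns, whatever the opponent does. Hence, unless the threshold is close to the true
probability, the player who is right wins (`gameVal_eq_of_forced`, `decision_eq`). The game tree has
`n ^ (2 * r)` leaves, which is polynomial.

Samples with atypical frequencies have probability `O(1 / n)` (`not_typical_le`) and cost at most
`n`, which gives the additive constant. -/

namespace CensoredIsing

/-! ### Executing programs -/

section Execution

/-- Program `p` takes the machine from state `s` to state `s'` within `T` units of time. -/
def Runs (tape : ℕ → ℕ) (coins : ℕ → Bool) (p : Prog) (s s' : State) (T : ℕ) : Prop :=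
  ∃ t ≤ T, ∀ k, (step tape coins)^[t] (p :: k, s) = (k, s')

variable {tape : ℕ → ℕ} {coins : ℕ → Bool} {p q : Prog} {s s₁ s' : State} {T T' : ℕ}

theorem Runs.mono (h : Runs tape coins p s s' T) (hT : T ≤ T') : Runs tape coins p s s' T' :=
  let ⟨t, ht, h⟩ := h; ⟨t, ht.trans hT, h⟩

theorem runs_assign (r : ℕ) (e : Arith) :
    Runs tape coins (.assign r e) s { s with reg := Function.update s.reg r (e.eval s) } 1 :=
  ⟨1, le_rfl, fun _ => rfl⟩

theorem runs_skip : Runs tape coins .skip s s 1 := ⟨1, le_rfl, fun _ => rfl⟩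

theorem runs_store (a : ℕ) (i e : Arith) :
    Runs tape coins (.store a i e) s { s with
      arr := Function.update s.arr a (Function.update (s.arr a) (i.eval s) (e.eval s)) } 1 :=
  ⟨1, le_rfl, fun _ => rfl⟩

theorem runs_flip (r : ℕ) :
    Runs tape coins (.flip r) s { s with
      reg := Function.update s.reg r (if coins s.coinPos then 1 else 0)
      coinPos := s.coinPos + 1 } 1 :=
  ⟨1, le_rfl, fun _ => rfl⟩

theorem runs_read (r : ℕ) :
    Runs tape coins (.read r) s { s with
      reg := Function.update s.reg r (tape s.tapePos)
      tapePos := s.tapePos + 1 } 1 :=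
  ⟨1, le_rfl, fun _ => rfl⟩

theorem Runs.seq (hp : Runs tape coins p s s₁ T) (hq : Runs tape coins q s₁ s' T') :
    Runs tape coins (.seq p q) s s' (T + T' + 1) := by
  obtain ⟨t, ht, h⟩ := hp
  obtain ⟨t', ht', h'⟩ := hq
  refine ⟨t' + (t + 1), by omega, fun k => ?_⟩
  rw [Function.iterate_add_apply, Function.iterate_succ_apply]
  simp only [step]
  rw [h, h']

theorem Runs.cond_pos {e₁ e₂ : Arith} (h : e₁.eval s < e₂.eval s)
    (hp : Runs tape coins p s s' T) : Runs tape coins (.cond e₁ e₂ p q) s s' (T + 1) := by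
  obtain ⟨t, ht, hp⟩ := hp
  refine ⟨t + 1, by omega, fun k => ?_⟩
  rw [Function.iterate_succ_apply]
  simp only [step, if_pos h]
  exact hp k

theorem Runs.cond_neg {e₁ e₂ : Arith} (h : ¬ e₁.eval s < e₂.eval s)
    (hq : Runs tape coins q s s' T) : Runs tape coins (.cond e₁ e₂ p q) s s' (T + 1) := by
  obtain ⟨t, ht, hq⟩ := hq
  refine ⟨t + 1, by omega, fun k => ?_⟩
  rw [Function.iterate_succ_apply]
  simp only [step, if_neg h]
  exact hq k

/-- A loop with an invariant indexed by the number of rounds. -/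
theorem runs_loop {e₁ e₂ : Arith} (N : ℕ) (Inv : ℕ → State → Prop)
    (hbody : ∀ m < N, ∀ s, Inv m s →
      e₁.eval s < e₂.eval s ∧ ∃ s', Runs tape coins p s s' T ∧ Inv (m + 1) s')
    (hend : ∀ s, Inv N s → ¬ e₁.eval s < e₂.eval s) (h0 : Inv 0 s) :
    ∃ s', Runs tape coins (.loop e₁ e₂ p) s s' (N * (T + 1) + 1) ∧ Inv N s' := by
  suffices H : ∀ j m s, m + j = N → Inv m s →
      ∃ s', Runs tape coins (.loop e₁ e₂ p) s s' (j * (T + 1) + 1) ∧ Inv N s' from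
    H N 0 s (by omega) h0
  intro j
  induction j with
  | zero =>
    intro m s hm hs
    obtain rfl : m = N := by omega
    refine ⟨s, ⟨1, by omega, fun k => ?_⟩, hs⟩
    simp only [Function.iterate_one, step, if_neg (hend s hs)]
  | succ j ih =>
    intro m s hm hs
    obtain ⟨hlt, s₁, ⟨t, ht, h⟩, hs₁⟩ := hbody m (by omega) s hs
    obtain ⟨s₂, ⟨t', ht', h'⟩, hs₂⟩ := ih (m + 1) s₁ (by omega) hs₁
    refine ⟨s₂, ⟨t' + (t + 1), by rw [Nat.succ_mul]; omega, fun k => ?_⟩, hs₂⟩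
    rw [Function.iterate_add_apply, Function.iterate_succ_apply]
    simp only [step, if_pos hlt]
    rw [h, h']

/-- For each value of register `r` below the value of register `0`, run `p`. -/
def forTo (r : ℕ) (p : Prog) : Prog :=
  .seq (.assign r (.const 0))
    (.loop (.reg r) (.reg 0) (.seq p (.assign r (.add (.reg r) (.const 1)))))

theorem runs_forTo {r n : ℕ} (Inv : ℕ → State → Prop)
    (hreg : ∀ m s, Inv m s → s.reg r = m ∧ s.reg 0 = n)
    (hbody : ∀ m < n, ∀ s, Inv m s → ∃ s', Runs tape coins p s s' T ∧
      Inv (m + 1) { s' with reg := Function.update s'.reg r (s'.reg r + 1) })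
    (h0 : Inv 0 { s with reg := Function.update s.reg r 0 }) :
    ∃ s', Runs tape coins (forTo r p) s s' (n * (T + 3) + 3) ∧ Inv n s' := by
  obtain ⟨s', hr, hs'⟩ := runs_loop (tape := tape) (coins := coins) (e₁ := .reg r) (e₂ := .reg 0)
    (p := .seq p (.assign r (.add (.reg r) (.const 1)))) (T := T + 2) n Inv
    (fun m hm s hs => by
      obtain ⟨h1, h2⟩ := hreg m s hs
      refine ⟨by simpa [Arith.eval, h1, h2] using hm, ?_⟩
      obtain ⟨s', hr, hs'⟩ := hbody m hm s hs
      exact ⟨_, (hr.seq (runs_assign _ _)).mono (by omega), by simpa [Arith.eval] using hs'⟩)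
    (fun s hs => by
      obtain ⟨h1, h2⟩ := hreg n s hs
      simp [Arith.eval, h1, h2]) h0
  exact ⟨s', ((runs_assign r (.const 0)).seq hr).mono (by
    change 1 + (n * (T + 3) + 1) + 1 ≤ _
    omega), hs'⟩

/-- Nested loops: `p` is run `n ^ d` times, where `n` is the value of register `0`. The counters
are the registers from `r` on. -/
def nest (p : Prog) : ℕ → ℕ → Prog
  | 0, _ => p
  | d + 1, r => forTo r (nest p d (r + 1))

/-- The registers from `r₀` on serve as loop counters, so the invariant must survive arbitrary
writes to them and the body must leave them alone. Nesting replaces the computation of `n ^ d`, as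
the machine cannot multiply. -/
theorem runs_nest {n : ℕ} (hn : 0 < n) (Inv : ℕ → State → Prop) (r₀ : ℕ)
    (hreg : ∀ m s, Inv m s → s.reg 0 = n)
    (hinv : ∀ m s r v, r₀ ≤ r → Inv m s → Inv m { s with reg := Function.update s.reg r v })
    (hbody : ∀ m s, Inv m s → ∃ s', Runs tape coins p s s' T ∧ (∀ r, r₀ ≤ r → s'.reg r = s.reg r) ∧
      Inv (m + 1) s') (hr₀ : 0 < r₀) (d : ℕ) :
    ∀ m s r, r₀ ≤ r → Inv m s → ∃ s', Runs tape coins (nest p d r) s s' ((T + 6 * d) * n ^ d) ∧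
      (∀ r', r₀ ≤ r' → r' < r → s'.reg r' = s.reg r') ∧ Inv (m + n ^ d) s' := by
  induction d with
  | zero =>
    intro m s r hr hs
    obtain ⟨s', h1, h2, h3⟩ := hbody m s hs
    exact ⟨s', by simpa [nest] using h1, fun r' h _ => h2 r' h, by simpa using h3⟩
  | succ d ih =>
    intro m s r hr hs
    obtain ⟨s', h1, -, -, h4, h5⟩ := runs_forTo (tape := tape) (coins := coins) (r := r) (n := n)
      (p := nest p d (r + 1)) (T := (T + 6 * d) * n ^ d) (s := s)
      (fun j t => t.reg r = j ∧ t.reg 0 = n ∧ (∀ r', r₀ ≤ r' → r' < r → t.reg r' = s.reg r') ∧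
        Inv (m + j * n ^ d) t)
      (fun j t ht => ⟨ht.1, ht.2.1⟩)
      (fun j hj t ht => by
        obtain ⟨a1, a2, a3, a4⟩ := ht
        obtain ⟨t', b1, b2, b3⟩ := ih (m + j * n ^ d) t (r + 1) (by omega) a4
        have e : t'.reg r = j := by rw [b2 r hr (by omega), a1]
        refine ⟨t', b1, by simp [e], ?_, ?_, ?_⟩
        · show Function.update t'.reg r _ 0 = n
          rw [Function.update_of_ne (by omega)]
          exact hreg _ _ b3
        · intro r' h h'
          show Function.update t'.reg r _ r' = _
          rw [Function.update_of_ne (by omega), b2 r' h (by omega), a3 r' h h']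
        · refine hinv _ _ _ _ hr ?_
          rw [Nat.succ_mul, ← Nat.add_assoc]
          exact b3)
      (by
        refine ⟨by simp, ?_, ?_, ?_⟩
        · show Function.update s.reg r _ 0 = n
          rw [Function.update_of_ne (by omega)]
          exact hreg _ _ hs
        · intro r' h h'
          show Function.update s.reg r _ r' = _
          rw [Function.update_of_ne (by omega)]
        · simpa using hinv _ _ _ _ hr hs)
    refine ⟨s', h1.mono ?_, h4, by rw [pow_succ, mul_comm]; exact h5⟩
    have : 1 ≤ n ^ d := Nat.one_le_pow _ _ hn
    have : n * 1 ≤ n * n ^ d := Nat.mul_le_mul_left _ this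
    calc n * ((T + 6 * d) * n ^ d + 3) + 3 ≤ (T + 6 * d) * (n * n ^ d) + 6 * (n * n ^ d) := by
          nlinarith
      _ = _ := by ring

end Execution

/-! ### The algorithm -/

section Algorithm

/-- `1` if one of the two symbols is `1` and the other `2`, and `0` for other symbols. -/
def mism (a b : ℕ) : ℕ := (a + b - 2) - ((a + b - 3) + (a + b - 3))

/-- The number of mismatches at the positions `c 0, …, c (len - 1)` between `y` and the sample
that starts at position `p` of `x`. -/
def mismSum (x y c : ℕ → ℕ) : ℕ → ℕ → ℕ
  | 0, _ => 0
  | len + 1, p => mismSum x y c len p + mism (x (p + c len)) (y (c len))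

/-- The number of samples among the first `N` that match `y`. -/
def matchCount (x y c : ℕ → ℕ) (n len N : ℕ) : ℕ :=
  ((Finset.range N).filter fun m => mismSum x y c len (m * n) < 1).card

/-- The number of samples among the first `N` that match `y` and have spin `1` at `i`. -/
def matchCountAt (x y c : ℕ → ℕ) (n len i N : ℕ) : ℕ :=
  ((Finset.range N).filter fun m => mismSum x y c len (m * n) < 1 ∧ x (m * n + i) < 2).card

/-- Whether the empirical conditional probability of the spin `1` at `i` exceeds `u / w`. -/
def leafVal (x y : ℕ → ℕ) (n len i N u w : ℕ) (c : ℕ → ℕ) : ℕ :=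
  if matchCount x y c n len N * u < matchCountAt x y c n len i N * w then 1 else 0

/-- The value of a game with `j` rounds in which two players alternately choose positions. -/
def gameVal (leaf : (ℕ → ℕ) → ℕ) (n : ℕ) : ℕ → ℕ → (ℕ → ℕ) → ℕ
  | 0, _, c => leaf c
  | j + 1, l, c => if ∀ a < n, gameVal leaf n j (l + 1) (Function.update c l a) = 0 then 1 else 0

/-- The number with the binary digits `coins off, …, coins (off + L - 1)`. -/
def coinWord (coins : ℕ → Bool) (off : ℕ) : ℕ → ℕ
  | 0 => 0
  | L + 1 => coinWord coins off L + coinWord coins off L + if coins (off + L) then 1 else 0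

/-- The configuration sampled by the algorithm after `t` vertices. -/
def sampled (x : ℕ → ℕ) (coins : ℕ → Bool) (n len N L : ℕ) : ℕ → ℕ → ℕ
  | 0 => 0
  | t + 1 => Function.update (sampled x coins n len N L t) t
      (2 - gameVal (leafVal x (sampled x coins n len N L t) n len t N
        (coinWord coins (t * L) L) (2 ^ L)) n len 0 0)

/-- Register layout: `0` holds `n`, `1` the number of stored symbols, `2` the current vertex, `3`
the threshold `u`, `4` a fresh coin or symbol, `5` the value of a game, `6` the start of the current
sample, `7` and `8` the two sides of the leaf comparison, `9 + 2 * l` the position chosen in round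
`l`, and `10 + 2 * l` the accumulator of that round. Array `0` holds the spins sampled so far, array
`1` the samples. -/
def mismExpr (l : ℕ) : Arith :=
  let e : Arith := .add (.get 1 (.add (.reg 6) (.reg (9 + 2 * l)))) (.get 0 (.reg (9 + 2 * l)))
  .sub (.sub e (.const 2)) (.add (.sub e (.const 3)) (.sub e (.const 3)))

def mismSumExpr : ℕ → Arith
  | 0 => .const 0
  | len + 1 => .add (mismSumExpr len) (mismExpr len)

/-- Repeated addition replaces multiplication: a match adds `u` to register `7`, and a match with
spin `1` at the current vertex adds `w` to register `8`. -/
def leafBody (len w : ℕ) : Prog :=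
  .seq
    (.cond (mismSumExpr len) (.const 1)
      (.seq (.assign 7 (.add (.reg 7) (.reg 3)))
        (.cond (.get 1 (.add (.reg 6) (.reg 2))) (.const 2)
          (.assign 8 (.add (.reg 8) (.const w))) .skip))
      .skip)
    (.assign 6 (.add (.reg 6) (.reg 0)))

def leafProg (len w : ℕ) : Prog :=
  .seq (.assign 6 (.const 0)) (.seq (.assign 7 (.const 0)) (.seq (.assign 8 (.const 0))
    (.seq (.loop (.reg 6) (.reg 1) (leafBody len w))
      (.cond (.reg 7) (.reg 8) (.assign 5 (.const 1)) (.assign 5 (.const 0))))))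

/-- The accumulator starts at `1`, and truncated subtraction of the children's values leaves it at
`1` exactly when all of them vanish. -/
def gameProg (leaf : Prog) : ℕ → ℕ → Prog
  | 0, _ => leaf
  | j + 1, l => .seq (.assign (10 + 2 * l) (.const 1))
      (.seq (forTo (9 + 2 * l) (.seq (gameProg leaf j (l + 1))
        (.assign (10 + 2 * l) (.sub (.reg (10 + 2 * l)) (.reg 5)))))
      (.assign 5 (.reg (10 + 2 * l))))

def flipProg : ℕ → Prog
  | 0 => .assign 3 (.const 0)
  | L + 1 => .seq (flipProg L)
      (.seq (.flip 4) (.assign 3 (.add (.add (.reg 3) (.reg 3)) (.reg 4))))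

def readBody : Prog :=
  .seq (.read 4) (.seq (.store 1 (.reg 1) (.reg 4)) (.assign 1 (.add (.reg 1) (.const 1))))

/-- The values `1` and `0` of the game are stored as `1` and `2`, the encoding of the tape. Censored
vertices are processed as well; their entries never mismatch the symbol `0` of the samples and are
not part of the output. -/
def vertexProg (len L : ℕ) : Prog :=
  .seq (flipProg L) (.seq (gameProg (leafProg len (2 ^ L)) len 0)
    (.store 0 (.reg 2) (.sub (.const 2) (.reg 5))))

/-- The algorithm: `n ^ q` samples are stored, and then the vertices are sampled in order. -/
def sampler (q len L : ℕ) : Prog :=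
  -- `n ^ q` samples occupy `n ^ (q + 1)` symbols.
  .seq (nest readBody (q + 1) 9) (forTo 2 (vertexProg len L))

/-! ### Correctness and running time of the programs. -/

variable {tape : ℕ → ℕ} {coins : ℕ → Bool}

theorem mismSumExpr_eval (s : State) (len : ℕ) :
    (mismSumExpr len).eval s =
      mismSum (s.arr 1) (s.arr 0) (fun l => s.reg (9 + 2 * l)) len (s.reg 6) := by
  induction len with
  | zero => rfl
  | succ len ih => simp only [mismSumExpr, mismSum, Arith.eval, ih, mismExpr, mism]

theorem mismSum_congr {x y c c' : ℕ → ℕ} {len p : ℕ} (h : ∀ l < len, c l = c' l) :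
    mismSum x y c len p = mismSum x y c' len p := by
  induction len with
  | zero => rfl
  | succ len ih =>
    simp only [mismSum]
    rw [ih fun l hl => h l (by omega), h len (by omega)]

theorem matchCount_succ (x y c : ℕ → ℕ) (n len m : ℕ) :
    matchCount x y c n len (m + 1) =
      matchCount x y c n len m + if mismSum x y c len (m * n) < 1 then 1 else 0 := by
  simp only [matchCount, Finset.range_add_one, Finset.filter_insert]
  split_ifs
  · rw [Finset.card_insert_of_notMem (by simp)]
  · rfl

theorem matchCountAt_succ (x y c : ℕ → ℕ) (n len i m : ℕ) :
    matchCountAt x y c n len i (m + 1) = matchCountAt x y c n len i m +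
      if mismSum x y c len (m * n) < 1 ∧ x (m * n + i) < 2 then 1 else 0 := by
  simp only [matchCountAt, Finset.range_add_one, Finset.filter_insert]
  split_ifs
  · rw [Finset.card_insert_of_notMem (by simp)]
  · rfl

theorem leafVal_congr {x y c c' : ℕ → ℕ} {n len i N u w : ℕ} (h : ∀ l < len, c l = c' l) :
    leafVal x y n len i N u w c = leafVal x y n len i N u w c' := by
  have e : mismSum x y c len = mismSum x y c' len := funext fun p => mismSum_congr h
  unfold leafVal matchCount matchCountAt
  rw [e]

/-- The entries from `l` on are overwritten in the remaining rounds before the leaf reads them. -/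
theorem gameVal_congr {leaf : (ℕ → ℕ) → ℕ} {n len : ℕ}
    (hleaf : ∀ c c', (∀ l < len, c l = c' l) → leaf c = leaf c') (j : ℕ) :
    ∀ l c c', l + j = len → (∀ i < l, c i = c' i) → gameVal leaf n j l c = gameVal leaf n j l c' := by
  induction j with
  | zero => rintro l c c' rfl h; exact hleaf _ _ h
  | succ j ih =>
    intro l c c' hl h
    simp only [gameVal]
    have : ∀ a, gameVal leaf n j (l + 1) (Function.update c l a) =
        gameVal leaf n j (l + 1) (Function.update c' l a) := fun a => by
      refine ih _ _ _ (by omega) fun i hi => ?_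
      by_cases hil : i = l
      · simp [hil]
      · rw [Function.update_of_ne hil, Function.update_of_ne hil, h i (by omega)]
    simp only [this]

theorem gameVal_le_one {leaf : (ℕ → ℕ) → ℕ} {n : ℕ} (hleaf : ∀ c, leaf c ≤ 1) (j l : ℕ)
    (c : ℕ → ℕ) : gameVal leaf n j l c ≤ 1 := by
  cases j with
  | zero => exact hleaf c
  | succ j => simp only [gameVal]; split_ifs <;> simp

/-- The states agree except for scratch registers; the first `l` pairs of loop registers are
not scratch. -/
def Same (l : ℕ) (s s' : State) : Prop :=
  s'.arr = s.arr ∧ s'.coinPos = s.coinPos ∧ s'.tapePos = s.tapePos ∧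
    ∀ r, r < 5 ∨ (9 ≤ r ∧ r < 9 + 2 * l) → s'.reg r = s.reg r

theorem Same.trans {l l' : ℕ} {s s₁ s' : State} (h : Same l s s₁) (h' : Same l' s₁ s')
    (hl : l ≤ l') : Same l s s' :=
  ⟨h'.1.trans h.1, h'.2.1.trans h.2.1, h'.2.2.1.trans h.2.2.1, fun r hr =>
    (h'.2.2.2 r (by omega)).trans (h.2.2.2 r hr)⟩

theorem same_update {l r v : ℕ} {s : State} (hr : ¬ (r < 5 ∨ (9 ≤ r ∧ r < 9 + 2 * l))) :
    Same l s { s with reg := Function.update s.reg r v } :=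
  ⟨rfl, rfl, rfl, fun r' hr' => Function.update_of_ne (by rintro rfl; exact hr hr') _ _⟩

theorem Same.rfl {l : ℕ} {s : State} : Same l s s := ⟨by rfl, by rfl, by rfl, fun _ _ => by rfl⟩

theorem runs_leafProg {s : State} {n N len w : ℕ} (hn : 0 < n) (h0 : s.reg 0 = n)
    (h1 : s.reg 1 = N * n) :
    ∃ s', Runs tape coins (leafProg len w) s s' (10 * N + 20) ∧ Same len s s' ∧
      s'.reg 5 = leafVal (s.arr 1) (s.arr 0) n len (s.reg 2) N (s.reg 3) w
        (fun l => s.reg (9 + 2 * l)) := by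
  set s₀ : State := { s with reg := Function.update (Function.update (Function.update s.reg 6 0) 7 0) 8 0 }
    with hs₀
  have hsame : ∀ t, Same len s t → t.reg 0 = n ∧ t.reg 1 = N * n ∧ t.reg 2 = s.reg 2 ∧
      t.reg 3 = s.reg 3 ∧ ∀ l < len, t.reg (9 + 2 * l) = s.reg (9 + 2 * l) := fun t ht =>
    ⟨by rw [ht.2.2.2 0 (by omega), h0], by rw [ht.2.2.2 1 (by omega), h1],
      ht.2.2.2 2 (by omega), ht.2.2.2 3 (by omega), fun l hl => ht.2.2.2 _ (by omega)⟩
  obtain ⟨s₁, hr, hs₁, -, h7, h8⟩ := runs_loop (tape := tape) (coins := coins) (e₁ := .reg 6)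
    (e₂ := .reg 1) (p := leafBody len w) (T := 8) (s := s₀) N
    (fun m t => Same len s t ∧ t.reg 6 = m * n ∧
      t.reg 7 = matchCount (s.arr 1) (s.arr 0) (fun l => s.reg (9 + 2 * l)) n len m * s.reg 3 ∧
      t.reg 8 = matchCountAt (s.arr 1) (s.arr 0) (fun l => s.reg (9 + 2 * l)) n len (s.reg 2) m * w)
    (fun m hm t ⟨hst, h6, h7, h8⟩ => by
      obtain ⟨a0, a1, a2, a3, a4⟩ := hsame t hst
      refine ⟨by simpa [Arith.eval, h6, a1] using Nat.mul_lt_mul_of_pos_right hm hn, ?_⟩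
      have hme : (mismSumExpr len).eval t =
          mismSum (s.arr 1) (s.arr 0) (fun l => s.reg (9 + 2 * l)) len (m * n) := by
        rw [mismSumExpr_eval, hst.1, h6, mismSum_congr a4]
      by_cases hmis : mismSum (s.arr 1) (s.arr 0) (fun l => s.reg (9 + 2 * l)) len (m * n) < 1
      · by_cases hsp : s.arr 1 (m * n + s.reg 2) < 2
        · refine ⟨_, (((Runs.cond_pos (by simpa [hme, Arith.eval] using hmis)
            ((runs_assign 7 _).seq (Runs.cond_pos (by simpa [Arith.eval, hst.1, h6, a2] using hsp)
              (runs_assign 8 _)))).seq (runs_assign 6 _))).mono (by omega), ?_, ?_, ?_, ?_⟩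
          · exact ((hst.trans (same_update (by omega)) le_rfl).trans (same_update (by omega))
              le_rfl).trans (same_update (by omega)) le_rfl
          · simp [Arith.eval, h6, a0, Nat.succ_mul]
          · simp [Arith.eval, h7, a3, matchCount_succ, hmis, Nat.add_mul]
          · simp [Arith.eval, h8, a3, matchCountAt_succ, hmis, Nat.add_mul, hsp]
        · refine ⟨_, (((Runs.cond_pos (by simpa [hme, Arith.eval] using hmis)
            ((runs_assign 7 _).seq (Runs.cond_neg (by simpa [Arith.eval, hst.1, h6, a2] using hsp)
              runs_skip))).seq (runs_assign 6 _))).mono (by omega), ?_, ?_, ?_, ?_⟩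
          · exact (hst.trans (same_update (by omega)) le_rfl).trans (same_update (by omega)) le_rfl
          · simp [Arith.eval, h6, a0, Nat.succ_mul]
          · simp [Arith.eval, h7, a3, matchCount_succ, hmis, Nat.add_mul]
          · simp [h8, matchCountAt_succ, hmis, hsp]
      · refine ⟨_, ((Runs.cond_neg (by simpa [hme, Arith.eval] using hmis)
            runs_skip).seq (runs_assign 6 _)).mono (by omega), ?_, ?_, ?_, ?_⟩
        · exact hst.trans (same_update (by omega)) le_rfl
        · simp [Arith.eval, h6, a0, Nat.succ_mul]
        · simp [h7, matchCount_succ, hmis]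
        · simp [h8, matchCountAt_succ, hmis])
    (fun t ⟨hst, h6, _, _⟩ => by simp [Arith.eval, h6, (hsame t hst).2.1])
    (by
      refine ⟨((same_update (by omega)).trans (same_update (by omega))
          le_rfl).trans (same_update (by omega)) le_rfl, ?_, ?_, ?_⟩
      · simp [hs₀]
      · simp [hs₀, matchCount]
      · simp [hs₀, matchCountAt])
  have hpre : ∀ {q s' T}, Runs tape coins q s₀ s' T →
      Runs tape coins (.seq (.assign 6 (.const 0)) (.seq (.assign 7 (.const 0))
        (.seq (.assign 8 (.const 0)) q))) s s' (T + 6) := fun hq =>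
    ((runs_assign 6 (.const 0)).seq ((runs_assign 7 (.const 0)).seq
      ((runs_assign 8 (.const 0)).seq hq))).mono (by omega)
  by_cases hlt : s₁.reg 7 < s₁.reg 8
  · refine ⟨_, (hpre (hr.seq (Runs.cond_pos (by simpa [Arith.eval] using hlt)
      (runs_assign 5 _)))).mono (by omega), hs₁.trans (same_update (by omega)) le_rfl, ?_⟩
    rw [h7, h8] at hlt
    simp [Arith.eval, leafVal, hlt]
  · refine ⟨_, (hpre (hr.seq (Runs.cond_neg (by simpa [Arith.eval] using hlt)
      (runs_assign 5 _)))).mono (by omega), hs₁.trans (same_update (by omega)) le_rfl, ?_⟩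
    rw [h7, h8] at hlt
    simp [Arith.eval, leafVal, hlt]

/-- `Env` collects what the leaf needs from the memory. It is insensitive to scratch registers,
including all loop registers, and therefore persists through the recursion. -/
theorem runs_gameProg {leafP : Prog} {leaf : (ℕ → ℕ) → ℕ} {n len T : ℕ} {Env : State → Prop}
    (hn : 0 < n) (hE : ∀ s s', Same 0 s s' → Env s → Env s') (hE0 : ∀ s, Env s → s.reg 0 = n)
    (hleaf : ∀ c c', (∀ l < len, c l = c' l) → leaf c = leaf c') (hleaf1 : ∀ c, leaf c ≤ 1)
    (hP : ∀ s, Env s → ∃ s', Runs tape coins leafP s s' T ∧ Same len s s' ∧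
      s'.reg 5 = leaf (fun l => s.reg (9 + 2 * l))) (j : ℕ) :
    ∀ l s, l + j = len → Env s →
      ∃ s', Runs tape coins (gameProg leafP j l) s s' ((T + 12 * j) * n ^ j) ∧ Same l s s' ∧
        s'.reg 5 = gameVal leaf n j l (fun l => s.reg (9 + 2 * l)) := by
  induction j with
  | zero =>
    rintro l s rfl hs
    obtain ⟨s', h1, h2, h3⟩ := hP s hs
    exact ⟨s', by simpa [gameProg] using h1, h2, h3⟩
  | succ j ih =>
    intro l s hl hs
    set c : ℕ → ℕ := fun l => s.reg (9 + 2 * l) with hc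
    set s₀ : State := { s with reg := Function.update s.reg (10 + 2 * l) 1 } with hs₀
    have hs₀' : Same l s s₀ := same_update (by omega)
    obtain ⟨s₁, hr, hs₁, -, hacc⟩ := runs_forTo (tape := tape) (coins := coins) (r := 9 + 2 * l)
      (n := n) (p := .seq (gameProg leafP j (l + 1))
        (.assign (10 + 2 * l) (.sub (.reg (10 + 2 * l)) (.reg 5))))
      (T := (T + 12 * j) * n ^ j + 2) (s := s₀)
      (fun a t => Same l s t ∧ t.reg (9 + 2 * l) = a ∧ t.reg (10 + 2 * l) =
        if ∀ a' < a, gameVal leaf n j (l + 1) (Function.update c l a') = 0 then 1 else 0)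
      (fun a t ⟨ht, ha, _⟩ => ⟨ha, hE0 t
        (hE s t ⟨ht.1, ht.2.1, ht.2.2.1, fun r hr => ht.2.2.2 r (by omega)⟩ hs)⟩)
      (fun a ha t ⟨ht, hra, hacc⟩ => by
        obtain ⟨t', hrt, hst, hres⟩ := ih (l + 1) t (by omega)
          (hE s t ⟨ht.1, ht.2.1, ht.2.2.1, fun r hr => ht.2.2.2 r (by omega)⟩ hs)
        have hg : t'.reg 5 = gameVal leaf n j (l + 1) (Function.update c l a) := by
          rw [hres]
          refine gameVal_congr hleaf j _ _ _ (by omega) fun i hi => ?_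
          by_cases hil : i = l
          · simp [hil, hra]
          · rw [Function.update_of_ne hil]
            exact ht.2.2.2 _ (by omega)
        refine ⟨_, (hrt.seq (runs_assign _ _)).mono (by omega), ?_, ?_, ?_⟩
        · exact ((ht.trans hst (by omega)).trans (same_update (by omega)) le_rfl).trans
            (same_update (by omega)) le_rfl
        · simp [hst.2.2.2 (9 + 2 * l) (by omega), hra]
        · have e : t'.reg (10 + 2 * l) = t.reg (10 + 2 * l) := hst.2.2.2 _ (by omega)
          have := gameVal_le_one (n := n) hleaf1 j (l + 1) (Function.update c l a)
          simp only [Arith.eval, Nat.forall_lt_succ_right]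
          rw [Function.update_of_ne (by omega), Function.update_self, e, hacc, hg]
          by_cases hb : ∀ a' < a, gameVal leaf n j (l + 1) (Function.update c l a') = 0
          · by_cases hv : gameVal leaf n j (l + 1) (Function.update c l a) = 0
            · rw [if_pos hb, if_pos ⟨hb, hv⟩, hv]
            · rw [if_pos hb, if_neg fun h => hv h.2]
              omega
          · rw [if_neg hb, if_neg fun h => hb h.1, Nat.zero_sub])
      (by
        refine ⟨hs₀'.trans (same_update (by omega)) le_rfl, by simp, ?_⟩
        simp [hs₀])
    refine ⟨_, ((runs_assign _ _).seq (hr.seq (runs_assign 5 _))).mono ?_,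
      hs₁.trans (same_update (by omega)) le_rfl, ?_⟩
    · have h1 : 1 ≤ n ^ j := Nat.one_le_pow _ _ hn
      have h2 : n * 1 ≤ n * n ^ j := Nat.mul_le_mul_left _ h1
      calc _ = (T + 12 * j) * (n * n ^ j) + 5 * n + 7 := by ring
        _ ≤ (T + 12 * j) * (n * n ^ j) + 12 * (n * n ^ j) := by omega
        _ = _ := by ring
    · simp [Arith.eval, hacc, gameVal]

theorem runs_flipProg (L : ℕ) (s : State) :
    ∃ s', Runs tape coins (flipProg L) s s' (4 * L + 1) ∧ s'.arr = s.arr ∧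
      s'.coinPos = s.coinPos + L ∧ s'.reg 3 = coinWord coins s.coinPos L ∧
      ∀ r, r ≠ 3 → r ≠ 4 → s'.reg r = s.reg r := by
  induction L with
  | zero =>
    refine ⟨_, runs_assign _ _, rfl, rfl, by simp [Arith.eval, coinWord], fun r h _ => ?_⟩
    exact Function.update_of_ne h _ _
  | succ L ih =>
    obtain ⟨s', hr, h1, h2, h3, h4⟩ := ih
    refine ⟨_, (hr.seq ((runs_flip 4).seq (runs_assign 3 _))).mono (by omega), h1, ?_, ?_, ?_⟩
    · simp [h2, add_assoc]
    · simp [Arith.eval, coinWord, h2, h3]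
    · intro r h h'
      simp [h, h', h4]

theorem runs_readProg {n : ℕ} (hn : 0 < n) (q : ℕ) :
    ∃ s', Runs tape coins (nest readBody q 9) (initState n) s' ((5 + 6 * q) * n ^ q) ∧
      s'.reg 0 = n ∧ s'.reg 1 = n ^ q ∧ s'.coinPos = 0 ∧ s'.arr 0 = 0 ∧
      s'.arr 1 = fun k => if k < n ^ q then tape k else 0 := by
  obtain ⟨s', hr, -, h⟩ := runs_nest (tape := tape) (coins := coins) (p := readBody) (T := 5) hn
    (fun m s => s.reg 0 = n ∧ s.reg 1 = m ∧ s.tapePos = m ∧ s.coinPos = 0 ∧ s.arr 0 = 0 ∧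
      s.arr 1 = fun k => if k < m then tape k else 0) 9 (fun m s h => h.1)
    (fun m s r v hr h => by
      refine ⟨?_, ?_, h.2.2⟩
      · exact (Function.update_of_ne (by omega) _ _).trans h.1
      · exact (Function.update_of_ne (by omega) _ _).trans h.2.1)
    (fun m s ⟨h0, h1, h2, h3, h4, h5⟩ => by
      refine ⟨_, ((runs_read 4).seq ((runs_store 1 _ _).seq (runs_assign 1 _))).mono (by omega),
        fun r hr => ?_, ?_, ?_, ?_, ?_, ?_, ?_⟩
      · simp [show r ≠ 1 by omega, show r ≠ 4 by omega]
      · simp [h0]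
      · simp [Arith.eval, h1]
      · simp [h2]
      · simp [h3]
      · simp [h4]
      · funext k
        simp only [Arith.eval, Function.update_self, h2]
        rcases lt_trichotomy k m with hk | rfl | hk
        · simp [hk.ne, h5, hk, hk.trans (Nat.lt_succ_self m), h1]
        · simp [h1]
        · simp [hk.ne', h5, show ¬ k < m by omega, show ¬ k < m + 1 by omega, h1])
    (by omega) q 0 (initState n) 9 le_rfl
    ⟨by simp [initState], by simp [initState], rfl, rfl, rfl, by funext k; simp [initState]⟩
  simp only [zero_add] at h
  exact ⟨s', hr, h.1, h.2.1, h.2.2.2.1, h.2.2.2.2.1, h.2.2.2.2.2⟩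

theorem leafVal_le_one (x y : ℕ → ℕ) (n len i N u w : ℕ) (c : ℕ → ℕ) :
    leafVal x y n len i N u w c ≤ 1 := by
  unfold leafVal; split_ifs <;> simp

theorem runs_vertexProg {s : State} {n N len L : ℕ} (hn : 0 < n) (h0 : s.reg 0 = n)
    (h1 : s.reg 1 = N * n) :
    ∃ s', Runs tape coins (vertexProg len L) s s'
        (4 * L + 4 + (10 * N + 20 + 12 * len) * n ^ len) ∧
      s'.reg 0 = n ∧ s'.reg 1 = N * n ∧ s'.reg 2 = s.reg 2 ∧ s'.coinPos = s.coinPos + L ∧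
      s'.arr 1 = s.arr 1 ∧ s'.arr 0 = Function.update (s.arr 0) (s.reg 2)
        (2 - gameVal (leafVal (s.arr 1) (s.arr 0) n len (s.reg 2) N
          (coinWord coins s.coinPos L) (2 ^ L)) n len 0 0) := by
  obtain ⟨s₁, hr, ha, hc, h3, hreg⟩ := runs_flipProg (tape := tape) (coins := coins) L s
  obtain ⟨s₂, hr₂, hs₂, h5⟩ := runs_gameProg (tape := tape) (coins := coins)
    (leafP := leafProg len (2 ^ L)) (len := len) (T := 10 * N + 20)
    (leaf := leafVal (s.arr 1) (s.arr 0) n len (s.reg 2) N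
      (coinWord coins s.coinPos L) (2 ^ L)) (Env := Same 0 s₁) hn
    (fun t t' h h' => h'.trans h le_rfl)
    (fun t h => by rw [h.2.2.2 0 (by omega), hreg 0 (by omega) (by omega), h0])
    (fun c c' h => leafVal_congr h) (leafVal_le_one _ _ _ _ _ _ _ _)
    (fun t ht => by
      obtain ⟨t', hr', hst, h5⟩ := runs_leafProg (tape := tape) (coins := coins) (s := t)
        (len := len) (w := 2 ^ L) (N := N) hn
        (by rw [ht.2.2.2 0 (by omega), hreg 0 (by omega) (by omega), h0])
        (by rw [ht.2.2.2 1 (by omega), hreg 1 (by omega) (by omega), h1])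
      refine ⟨t', hr', hst, ?_⟩
      rw [h5, ht.1, ha, ht.2.2.2 2 (by omega), hreg 2 (by omega) (by omega),
        ht.2.2.2 3 (by omega), h3])
    len 0 s₁ (by omega) Same.rfl
  have e : ∀ r < 5, s₂.reg r = s₁.reg r := fun r hr => hs₂.2.2.2 r (Or.inl hr)
  refine ⟨_, (hr.seq (hr₂.seq (runs_store 0 _ _))).mono (by omega), ?_, ?_, ?_, ?_, ?_, ?_⟩
  · rw [← h0, ← hreg 0 (by omega) (by omega)]; exact e 0 (by omega)
  · rw [← h1, ← hreg 1 (by omega) (by omega)]; exact e 1 (by omega)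
  · rw [← hreg 2 (by omega) (by omega)]; exact e 2 (by omega)
  · rw [← hc]; exact hs₂.2.1
  · simp [hs₂.1, ha]
  -- The choice registers contain leftovers from earlier vertices; a full game ignores them, so they
  -- may be replaced by `0`.
  · rw [gameVal_congr (fun c c' h => leafVal_congr h) len 0 _ 0 (by omega) (by simp)] at h5
    simp [Arith.eval, hs₂.1, ha, e 2 (by omega), hreg 2 (by omega) (by omega), h5]

/-- The memory that the algorithm works with: the first `m` symbols of the tape. -/
def stored (tape : ℕ → ℕ) (m : ℕ) : ℕ → ℕ := fun k => if k < m then tape k else 0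

theorem runs_sampler {n : ℕ} (hn : 0 < n) (q len L : ℕ) :
    ∃ s', Runs tape coins (sampler q len L) (initState n) s'
        ((4 * L + 6 * q + 12 * len + 60) * n ^ (q + len + 1)) ∧
      s'.arr 0 = sampled (stored tape (n ^ (q + 1))) coins n len (n ^ q) L n := by
  obtain ⟨s₁, hr, h0, h1, hc, ha0, ha1⟩ := runs_readProg (tape := tape) (coins := coins) hn (q + 1)
  obtain ⟨s₂, hr₂, -, -, -, -, -, h⟩ := runs_forTo (tape := tape) (coins := coins) (r := 2) (n := n)
    (p := vertexProg len L) (T := 4 * L + 4 + (10 * n ^ q + 20 + 12 * len) * n ^ len) (s := s₁)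
    (fun i t => t.reg 2 = i ∧ t.reg 0 = n ∧ t.reg 1 = n ^ q * n ∧ t.coinPos = i * L ∧
      t.arr 1 = stored tape (n ^ (q + 1)) ∧
      t.arr 0 = sampled (stored tape (n ^ (q + 1))) coins n len (n ^ q) L i)
    (fun i t h => ⟨h.1, h.2.1⟩)
    (fun i hi t ⟨h2, h0, h1, hc, ha1, ha0⟩ => by
      obtain ⟨t', hr', b0, b1, b2, bc, ba1, ba0⟩ := runs_vertexProg (tape := tape) (coins := coins)
        (len := len) (L := L) hn h0 h1
      refine ⟨t', hr', ?_, ?_, ?_, ?_, ?_, ?_⟩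
      · simp [b2, h2]
      · simp [b0]
      · simp [b1]
      · simp [bc, hc, Nat.succ_mul]
      · rw [ba1, ha1]
      · rw [ba0, ha0, ha1, h2, hc]; rfl)
    ⟨by simp, by simp [h0], by simp [h1, pow_succ], by simpa using hc, ha1, ha0⟩
  refine ⟨s₂, (hr.seq hr₂).mono ?_, h⟩
  have p1 : 1 ≤ n ^ q := Nat.one_le_pow _ _ hn
  have p2 : 1 ≤ n ^ len := Nat.one_le_pow _ _ hn
  have e1 : n ^ (q + 1) = n * n ^ q := by ring
  have e2 : n ^ (q + len + 1) = n * (n ^ q * n ^ len) := by ring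
  have p3 : n ^ q ≤ n ^ q * n ^ len := Nat.le_mul_of_pos_right _ p2
  have p4 : n ^ len ≤ n ^ q * n ^ len := Nat.le_mul_of_pos_left _ p1
  rw [e1, e2]
  set P := n ^ q * n ^ len
  have p5 : 1 ≤ n * P := Nat.mul_pos hn (by omega)
  calc (5 + 6 * (q + 1)) * (n * n ^ q) +
        (n * (4 * L + 4 + (10 * n ^ q + 20 + 12 * len) * n ^ len + 3) + 3) + 1
      = (11 + 6 * q) * (n * n ^ q) + (4 * L + 7) * (n * 1) + 10 * (n * P) +
        (20 + 12 * len) * (n * n ^ len) + 4 * 1 := by ring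
    _ ≤ (11 + 6 * q) * (n * P) + (4 * L + 7) * (n * P) + 10 * (n * P) +
        (20 + 12 * len) * (n * P) + 4 * (n * P) := by
        gcongr; omega
    _ ≤ _ := by nlinarith

theorem sampler_halts {n : ℕ} (hn : 0 < n) (q len L : ℕ) (S : Finset (Fin n)) :
    RunsInTime (sampler q len L) S ((4 * L + 6 * q + 12 * len + 60) * n ^ (q + len + 1)) := by
  intro x coins
  obtain ⟨s', ⟨t, ht, h⟩, -⟩ := runs_sampler (tape := sampleTape S x) (coins := coins) hn q len L
  obtain ⟨e, he⟩ := Nat.exists_eq_add_of_le' ht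
  rw [configAt, he, Function.iterate_add_apply, h []]
  exact congrArg Prod.fst (Function.iterate_fixed (f := step _ _) (x := ([], s')) rfl e)

/-- A halted configuration is fixed by `step`, so the first halting time yields the same state as
the later time at which the run is known to have ended. -/
theorem output_sampler {n : ℕ} (hn : 0 < n) (q len L : ℕ) (S : Finset (Fin n))
    (x : ℕ → S → Bool) (coins : ℕ → Bool) (i : S) :
    output (sampler q len L) S x coins i =
      decide (sampled (stored (sampleTape S x) (n ^ (q + 1))) coins n len (n ^ q) L n i.1 = 1) := by
  obtain ⟨s', ⟨t, ht, h⟩, hs'⟩ :=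
    runs_sampler (tape := sampleTape S x) (coins := coins) hn q len L
  have hex : ∃ t, (configAt (sampler q len L) S x coins t).1 = [] := ⟨t, by rw [configAt, h []]⟩
  have key : configAt (sampler q len L) S x coins (Nat.find hex) = ([], s') := by
    have h1 := Nat.find_spec hex
    obtain ⟨e, he⟩ := Nat.exists_eq_add_of_le' (Nat.find_min' hex (m := t) (by rw [configAt, h []]))
    have h2 : configAt (sampler q len L) S x coins t = ([], s') := h []
    rw [configAt, he, Function.iterate_add_apply] at h2
    rw [← h2]
    refine (Function.iterate_fixed (f := step _ _) (x := _) ?_ e).symm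
    generalize configAt (sampler q len L) S x coins (Nat.find hex) = C at h1
    obtain ⟨k, s⟩ := C
    obtain rfl : k = [] := h1
    rfl
  rw [output, dif_pos hex, key]
  simp only [hs']

end Algorithm

/-! ### Dobrushin's comparison theorem -/

section Dobrushin

variable {n : ℕ} {M : Matrix (Fin n) (Fin n) ℝ} {θ : Fin n → ℝ}

/-- The derivative `σ (1 - σ)` is at most `1 / 4`. -/
theorem sigmoid_sub_le (x y : ℝ) : |Real.sigmoid x - Real.sigmoid y| ≤ 1 / 4 * |x - y| := by
  have := Convex.norm_image_sub_le_of_norm_deriv_le (f := Real.sigmoid) (s := Set.univ) (C := 1 / 4)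
    (x := y) (y := x) (fun z _ => differentiable_sigmoid z) (fun z _ => by
      rw [Real.deriv_sigmoid, Real.norm_eq_abs, abs_le]
      constructor <;> nlinarith [sq_nonneg (Real.sigmoid z - 1 / 2), Real.sigmoid_nonneg z,
        Real.sigmoid_le_one z, mul_nonneg (Real.sigmoid_nonneg z)
          (sub_nonneg.2 (Real.sigmoid_le_one z))]) convex_univ trivial trivial
  simpa using this

/-- The local field at `v`. -/
noncomputable def localField (M : Matrix (Fin n) (Fin n) ℝ) (θ : Fin n → ℝ) (v : Fin n)
    (x : Fin n → Bool) : ℝ := θ v + ∑ w, M v w * spin (x w)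

/-- The conditional probability of the spin `1` at `v` given all other spins. -/
noncomputable def siteProb (M : Matrix (Fin n) (Fin n) ℝ) (θ : Fin n → ℝ) (v : Fin n)
    (x : Fin n → Bool) : ℝ := Real.sigmoid (2 * localField M θ v x)

/-- Averaging over the spin at `v`. -/
noncomputable def glauber (M : Matrix (Fin n) (Fin n) ℝ) (θ : Fin n → ℝ) (v : Fin n)
    (f : (Fin n → Bool) → ℝ) (x : Fin n → Bool) : ℝ :=
  siteProb M θ v x * f (Function.update x v true) +
    (1 - siteProb M θ v x) * f (Function.update x v false)

theorem abs_spin_sub_le (s t : Bool) : |spin s - spin t| ≤ 2 := by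
  cases s <;> cases t <;> norm_num [spin]

theorem abs_spin (s : Bool) : |spin s| = 1 := by cases s <;> norm_num [spin]

theorem siteProb_nonneg (v : Fin n) (x : Fin n → Bool) : 0 ≤ siteProb M θ v x :=
  Real.sigmoid_nonneg _

theorem siteProb_le_one (v : Fin n) (x : Fin n → Bool) : siteProb M θ v x ≤ 1 :=
  Real.sigmoid_le_one _

/-- The local field moves by at most `2 |M v w|`, it enters the sigmoid with a factor `2`, and the
sigmoid has Lipschitz constant `1 / 4`. Thus `|M v w|` bounds the Dobrushin influence of `w` on `v`.
-/
theorem siteProb_update_sub_le (v w : Fin n) (x : Fin n → Bool) (s : Bool) :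
    |siteProb M θ v x - siteProb M θ v (Function.update x w s)| ≤ |M v w| := by
  refine (sigmoid_sub_le _ _).trans ?_
  have : localField M θ v x - localField M θ v (Function.update x w s) =
      M v w * (spin (x w) - spin s) := by
    simp only [localField, add_sub_add_left_eq_sub, ← Finset.sum_sub_distrib]
    rw [Finset.sum_eq_single w]
    · simp [mul_sub]
    · intro j _ hj
      simp [Function.update_of_ne hj]
    · simp
  rw [← mul_sub, this, abs_mul, abs_mul]
  have := abs_spin_sub_le (x w) s
  rw [abs_two]
  nlinarith [abs_nonneg (M v w)]

/-- The exponent is affine in the spin at `v` with slope the local field: symmetry merges the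
contributions of row and column `v`, and the zero diagonal removes the quadratic term. -/
theorem isingWeight_update (hM : M.IsSymm) (hM0 : ∀ i, M i i = 0) (v : Fin n) (x : Fin n → Bool) :
    isingWeight M θ (Function.update x v true) =
      Real.exp (2 * localField M θ v x) * isingWeight M θ (Function.update x v false) := by
  rw [isingWeight, isingWeight, ← Real.exp_add]
  congr 1
  have hd : ∀ f : Fin n → ℝ, ∑ i, f i = f v + ∑ i ∈ Finset.univ.erase v, f i := fun f =>
    (Finset.add_sum_erase _ _ (Finset.mem_univ v)).symm
  have hu : ∀ s : Bool, ∀ i ∈ Finset.univ.erase v,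
      spin (Function.update x v s i) = spin (x i) := fun s i hi => by
    rw [Function.update_of_ne (Finset.ne_of_mem_erase hi)]
  have expand : ∀ s : Bool,
      (θ ⬝ᵥ fun i => spin (Function.update x v s i)) +
        1 / 2 * ((fun i => spin (Function.update x v s i)) ⬝ᵥ
          (M *ᵥ fun i => spin (Function.update x v s i))) =
      spin s * localField M θ v x + (∑ i ∈ Finset.univ.erase v, θ i * spin (x i) +
        1 / 2 * ∑ i ∈ Finset.univ.erase v, spin (x i) *
          ∑ j ∈ Finset.univ.erase v, M i j * spin (x j)) := by
    intro s
    have h1 : ∀ i ∈ Finset.univ.erase v, (fun i => spin (Function.update x v s i)) i *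
        (M *ᵥ fun i => spin (Function.update x v s i)) i =
        spin s * (M v i * spin (x i)) +
          spin (x i) * ∑ j ∈ Finset.univ.erase v, M i j * spin (x j) := fun i hi => by
      simp only [Matrix.mulVec, dotProduct]
      rw [hu s i hi, hd, Function.update_self, Finset.sum_congr rfl fun j hj => by rw [hu s j hj],
        ← hM.apply]
      ring
    have h2 : ∀ i ∈ Finset.univ.erase v, θ i * spin (Function.update x v s i) = θ i * spin (x i) :=
      fun i hi => by rw [hu s i hi]
    have h3 : (M *ᵥ fun i => spin (Function.update x v s i)) v =
        ∑ j ∈ Finset.univ.erase v, M v j * spin (x j) := by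
      simp only [Matrix.mulVec, dotProduct]
      rw [hd, hM0, zero_mul, zero_add]
      exact Finset.sum_congr rfl fun j hj => by rw [hu s j hj]
    have h4 : localField M θ v x = θ v + ∑ j ∈ Finset.univ.erase v, M v j * spin (x j) := by
      rw [localField, hd, hM0, zero_mul, zero_add]
    simp only [dotProduct]
    rw [hd, hd, Finset.sum_congr rfl h1, Function.update_self, Finset.sum_congr rfl h2,
      Finset.sum_add_distrib, h3, h4, ← Finset.mul_sum]
    ring
  rw [expand, expand]
  simp only [spin]
  norm_num
  ring

theorem siteProb_eq (hM : M.IsSymm) (hM0 : ∀ i, M i i = 0) (v : Fin n) (x : Fin n → Bool) :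
    siteProb M θ v x * (isingWeight M θ (Function.update x v true) +
      isingWeight M θ (Function.update x v false)) = isingWeight M θ (Function.update x v true) := by
  rw [isingWeight_update hM hM0, siteProb, Real.sigmoid_def, Real.exp_neg]
  have := Real.exp_pos (2 * localField M θ v x)
  field_simp

theorem two_mul_sum_eq (v : Fin n) (g : (Fin n → Bool) → ℝ) :
    2 * ∑ x, g x = ∑ x, (g (Function.update x v true) + g (Function.update x v false)) := by
  have h : ∀ x : Fin n → Bool, g (Function.update x v true) + g (Function.update x v false) =
      g x + g (Function.update x v (!x v)) := fun x => by
    rcases hx : x v with _ | _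
    · rw [add_comm, ← hx, Function.update_eq_self, hx]; rfl
    · rw [← hx, Function.update_eq_self, hx]; rfl
  have hinv : ∑ x : Fin n → Bool, g (Function.update x v (!x v)) = ∑ x, g x :=
    Fintype.sum_bijective (fun x : Fin n → Bool => Function.update x v (!x v))
      (Function.Involutive.bijective fun x => by simp) _ _ fun _ => rfl
  rw [Finset.sum_congr rfl fun x _ => h x, Finset.sum_add_distrib, hinv, two_mul]

/-- A weight is invariant under resampling the spin at `v`. -/
def GlauberInvariant (M : Matrix (Fin n) (Fin n) ℝ) (θ : Fin n → ℝ) (v : Fin n)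
    (μ : (Fin n → Bool) → ℝ) : Prop :=
  ∀ f : (Fin n → Bool) → ℝ, ∑ x, μ x * f x = ∑ x, μ x * glauber M θ v f x

/-- A factor that does not depend on the spin at `v` cancels from the conditional law of that spin.
With `g` an indicator, this covers conditioning on other vertices. The proof pairs each
configuration with its flip at `v`. -/
theorem glauberInvariant_isingWeight (hM : M.IsSymm) (hM0 : ∀ i, M i i = 0) (v : Fin n)
    (g : (Fin n → Bool) → ℝ) (hg : ∀ x s, g (Function.update x v s) = g x) :
    GlauberInvariant M θ v fun x => isingWeight M θ x * g x := by
  intro f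
  have hsp : ∀ x s, siteProb M θ v (Function.update x v s) = siteProb M θ v x := fun x s => by
    have h1 := siteProb_update_sub_le (M := M) (θ := θ) v v x s
    rw [hM0, abs_zero] at h1
    linarith [abs_nonpos_iff.1 h1]
  have hgl : ∀ x s, glauber M θ v f (Function.update x v s) = glauber M θ v f x := fun x s => by
    simp [glauber, hsp]
  have : 2 * ∑ x, isingWeight M θ x * g x * f x =
      2 * ∑ x, isingWeight M θ x * g x * glauber M θ v f x := by
    rw [two_mul_sum_eq v, two_mul_sum_eq v]
    refine Finset.sum_congr rfl fun x _ => ?_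
    simp only [hg, hgl]
    have e := siteProb_eq (θ := θ) hM hM0 v x
    rw [glauber]
    linear_combination g x * (f (Function.update x v false) - f (Function.update x v true)) * e
  linarith

/-! ### Oscillations and estimate vectors. -/

/-- Changing the spin at `v` changes `f` by at most `δ v`. -/
def Osc (f : (Fin n → Bool) → ℝ) (δ : Fin n → ℝ) : Prop :=
  ∀ x v s, |f x - f (Function.update x v s)| ≤ δ v

theorem Osc.nonneg {f : (Fin n → Bool) → ℝ} {δ : Fin n → ℝ} (h : Osc f δ) (v : Fin n) : 0 ≤ δ v :=
  (abs_nonneg _).trans (h (fun _ => true) v true)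

theorem Osc.abs_sub_le {f : (Fin n → Bool) → ℝ} {δ : Fin n → ℝ} (h : Osc f δ)
    (x y : Fin n → Bool) : |f x - f y| ≤ ∑ v, if x v ≠ y v then δ v else 0 := by
  have key : ∀ B : Finset (Fin n),
      |f x - f (B.piecewise y x)| ≤ ∑ v ∈ B, if x v ≠ y v then δ v else 0 := by
    intro B
    induction B using Finset.induction_on with
    | empty => simp
    | insert v B hv ih =>
      rw [Finset.piecewise_insert, Finset.sum_insert hv]
      by_cases hxy : x v = y v
      · rw [show Function.update (B.piecewise y x) v (y v) = B.piecewise y x by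
          rw [Function.update_eq_self_iff, Finset.piecewise_eq_of_notMem _ _ _ hv, hxy]]
        simpa [hxy] using ih
      · rw [if_pos hxy]
        have := h (B.piecewise y x) v (y v)
        calc _ ≤ |f x - f (B.piecewise y x)| + |f (B.piecewise y x) -
                f (Function.update (B.piecewise y x) v (y v))| := _root_.abs_sub_le _ _ _
          _ ≤ _ := by linarith
  simpa using key Finset.univ

/-- Averaging removes the dependence on the spin at `v`. Another spin `w` acts directly, by at most
`δ w`, and through the probability at `v`, which moves by at most `|M v w|` and multiplies a
difference of at most `δ v`. -/
theorem Osc.glauber (hM0 : ∀ i, M i i = 0) {f : (Fin n → Bool) → ℝ} {δ : Fin n → ℝ}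
    (h : Osc f δ) (v : Fin n) :
    Osc (glauber M θ v f) fun w => if w = v then 0 else δ w + |M v w| * δ v := by
  intro x w s
  by_cases hw : w = v
  · subst hw
    have h1 := siteProb_update_sub_le (M := M) (θ := θ) w w x s
    rw [hM0, abs_zero] at h1
    have h2 : siteProb M θ w (Function.update x w s) = siteProb M θ w x := by
      linarith [abs_nonpos_iff.1 h1]
    simp [CensoredIsing.glauber, h2]
  · simp only [if_neg hw]
    have hc : ∀ t, Function.update (Function.update x w s) v t =
        Function.update (Function.update x v t) w s := fun t => Function.update_comm hw _ _ _
    simp only [CensoredIsing.glauber, hc]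
    set p := siteProb M θ v x
    set p' := siteProb M θ v (Function.update x w s)
    have hp : |p - p'| ≤ |M v w| := siteProb_update_sub_le v w x s
    have hp0 : 0 ≤ p := siteProb_nonneg v x
    have hp1 : p ≤ 1 := siteProb_le_one v x
    have h1 := h (Function.update x v true) w s
    have h2 := h (Function.update x v false) w s
    have h3 := h (Function.update (Function.update x v true) w s) v false
    rw [Function.update_comm hw, Function.update_idem] at h3
    set a := f (Function.update x v true)
    set b := f (Function.update x v false)
    set a' := f (Function.update (Function.update x v true) w s)
    set b' := f (Function.update (Function.update x v false) w s)
    have e : p * a + (1 - p) * b - (p' * a' + (1 - p') * b') =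
      p * (a - a') + (1 - p) * (b - b') + (p - p') * (a' - b') := by ring
    rw [e]
    calc _ ≤ |p * (a - a')| + |(1 - p) * (b - b')| + |(p - p') * (a' - b')| := abs_add_three _ _ _
      _ = p * |a - a'| + (1 - p) * |b - b'| + |p - p'| * |a' - b'| := by
        rw [abs_mul, abs_mul, abs_mul, abs_of_nonneg hp0, abs_of_nonneg (sub_nonneg.2 hp1)]
      _ ≤ p * δ w + (1 - p) * δ w + |M v w| * δ v := by gcongr
      _ = _ := by ring

/-- The vector `a` bounds how much expectations with respect to `μ` and `ν` differ. -/
def IsEstimate (μ ν : (Fin n → Bool) → ℝ) (a : Fin n → ℝ) : Prop :=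
  ∀ f δ, Osc f δ → |∑ x, μ x * f x - ∑ x, ν x * f x| ≤ ∑ v, a v * δ v

theorem IsEstimate.mono {μ ν : (Fin n → Bool) → ℝ} {a a' : Fin n → ℝ} (h : IsEstimate μ ν a)
    (ha : ∀ v, a v ≤ a' v) : IsEstimate μ ν a' := fun f δ hf =>
  (h f δ hf).trans (Finset.sum_le_sum fun v _ => mul_le_mul_of_nonneg_right (ha v) (hf.nonneg v))

/-- Under the product coupling the two configurations differ only on `E`. -/
theorem isEstimate_of_agree {μ ν : (Fin n → Bool) → ℝ} (hμ : ∀ x, 0 ≤ μ x) (hν : ∀ x, 0 ≤ ν x)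
    (hμ1 : ∑ x, μ x = 1) (hν1 : ∑ x, ν x = 1) (E : Finset (Fin n))
    (h : ∀ x y, μ x ≠ 0 → ν y ≠ 0 → ∀ v, v ∉ E → x v = y v) :
    IsEstimate μ ν fun v => if v ∈ E then 1 else 0 := by
  intro f δ hf
  have e1 : ∑ x, μ x * f x = ∑ x, ∑ y, μ x * ν y * f x := by
    refine Finset.sum_congr rfl fun x _ => ?_
    rw [← Finset.sum_mul, ← Finset.mul_sum, hν1, mul_one]
  have e2 : ∑ x, ν x * f x = ∑ x, ∑ y, μ x * ν y * f y := by
    rw [Finset.sum_comm]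
    refine Finset.sum_congr rfl fun x _ => ?_
    rw [← Finset.sum_mul, ← Finset.sum_mul, hμ1, one_mul]
  have e3 : ∑ x, ∑ y, μ x * ν y = 1 := by
    rw [← hμ1]
    exact Finset.sum_congr rfl fun x _ => by rw [← Finset.mul_sum, hν1, mul_one]
  rw [e1, e2, ← Finset.sum_sub_distrib]
  simp only [← Finset.sum_sub_distrib, ← mul_sub]
  calc _ ≤ ∑ x, ∑ y, μ x * ν y * ∑ v, (if v ∈ E then 1 else 0) * δ v := by
        refine (Finset.abs_sum_le_sum_abs _ _).trans (Finset.sum_le_sum fun x _ =>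
          (Finset.abs_sum_le_sum_abs _ _).trans (Finset.sum_le_sum fun y _ => ?_))
        rw [abs_mul, abs_of_nonneg (mul_nonneg (hμ x) (hν y))]
        by_cases h0 : μ x * ν y = 0
        · simp [h0]
        refine mul_le_mul_of_nonneg_left ((hf.abs_sub_le x y).trans
          (Finset.sum_le_sum fun v _ => ?_)) (mul_nonneg (hμ x) (hν y))
        by_cases hv : v ∈ E
        · simp only [hv, if_true, one_mul]
          split_ifs
          exacts [le_rfl, hf.nonneg v]
        · simp [hv, h x y (left_ne_zero_of_mul h0) (right_ne_zero_of_mul h0) v hv]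
    _ = _ := by simp only [← Finset.sum_mul, e3, one_mul]

/-- Dual to `Osc.glauber`: both expectations are unchanged when `f` is averaged at `v`, and
collecting the coefficient of `δ v` in the resulting bound gives the new entry. -/
theorem IsEstimate.update (hM0 : ∀ i, M i i = 0) {μ ν : (Fin n → Bool) → ℝ} {a : Fin n → ℝ}
    (h : IsEstimate μ ν a) {v : Fin n} (hμ : GlauberInvariant M θ v μ)
    (hν : GlauberInvariant M θ v ν) :
    IsEstimate μ ν (Function.update a v (∑ w, |M v w| * a w)) := by
  intro f δ hf
  rw [hμ f, hν f]
  refine (h _ _ (hf.glauber hM0 v)).trans (le_of_eq ?_)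
  have hd : ∀ f : Fin n → ℝ, ∑ i, f i = f v + ∑ i ∈ Finset.univ.erase v, f i := fun f =>
    (Finset.add_sum_erase _ _ (Finset.mem_univ v)).symm
  rw [hd, hd (fun i => Function.update a v (∑ w, |M v w| * a w) i * δ i), Function.update_self,
    hd (fun w => |M v w| * a w), hM0]
  simp only [if_true, mul_zero, abs_zero, zero_mul, zero_add, Finset.sum_mul,
    ← Finset.sum_add_distrib]
  refine Finset.sum_congr rfl fun w hw => ?_
  rw [Function.update_of_ne (Finset.ne_of_mem_erase hw), if_neg (Finset.ne_of_mem_erase hw)]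
  ring

/-- One round of improving an estimate at the sites outside `A`. -/
noncomputable def improve (M : Matrix (Fin n) (Fin n) ℝ) (A : Finset (Fin n)) (a : Fin n → ℝ)
    (v : Fin n) : ℝ := if v ∈ A then a v else ∑ w, |M v w| * a w

theorem improve_mono {A : Finset (Fin n)} {a a' : Fin n → ℝ} (h : ∀ v, a v ≤ a' v) (v : Fin n) :
    improve M A a v ≤ improve M A a' v := by
  unfold improve
  split_ifs
  · exact h v
  · exact Finset.sum_le_sum fun w _ => mul_le_mul_of_nonneg_left (h w) (abs_nonneg _)

/-- Sites are updated one after another. By `ha` the entries already updated have not grown, so each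
sequential update is at least as good as the simultaneous one. -/
theorem IsEstimate.improve (hM0 : ∀ i, M i i = 0) {μ ν : (Fin n → Bool) → ℝ} {a : Fin n → ℝ}
    (h : IsEstimate μ ν a) {A : Finset (Fin n)} (hμ : ∀ v, v ∉ A → GlauberInvariant M θ v μ)
    (hν : ∀ v, v ∉ A → GlauberInvariant M θ v ν)
    (ha : ∀ v, CensoredIsing.improve M A a v ≤ a v) :
    IsEstimate μ ν (CensoredIsing.improve M A a) := by
  have key : ∀ B : Finset (Fin n), IsEstimate μ ν (B.piecewise (CensoredIsing.improve M A a) a) := by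
    intro B
    induction B using Finset.induction_on with
    | empty => simpa using h
    | insert v B hv ih =>
      rw [Finset.piecewise_insert]
      by_cases hvA : v ∈ A
      · rwa [show Function.update (B.piecewise (CensoredIsing.improve M A a) a) v
            (CensoredIsing.improve M A a v) = B.piecewise (CensoredIsing.improve M A a) a by
          rw [Function.update_eq_self_iff, Finset.piecewise_eq_of_notMem _ _ _ hv,
            CensoredIsing.improve, if_pos hvA]]
      · refine (ih.update hM0 (hμ v hvA) (hν v hvA)).mono fun w => ?_
        by_cases hw : w = v
        · subst hw
          rw [Function.update_self, Function.update_self, CensoredIsing.improve, if_neg hvA]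
          refine Finset.sum_le_sum fun u _ => mul_le_mul_of_nonneg_left ?_ (abs_nonneg _)
          by_cases hu : u ∈ B
          · rw [Finset.piecewise_eq_of_mem _ _ _ hu]; exact ha u
          · rw [Finset.piecewise_eq_of_notMem _ _ _ hu]
        · rw [Function.update_of_ne hw, Function.update_of_ne hw]
  simpa using key Finset.univ

/-! ### Weights of walks and the comparison theorem. -/

/-- The total weight of the paths of length between `1` and `m` from `i` to `j`. -/
noncomputable def pathWeight (M : Matrix (Fin n) (Fin n) ℝ) : ℕ → Fin n → Fin n → ℝ
  | 0, _, _ => 0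
  | m + 1, i, j => ∑ w, |M i w| * ((if w = j then 1 else 0) + pathWeight M m w j)

theorem pathWeight_nonneg (m : ℕ) (i j : Fin n) : 0 ≤ pathWeight M m i j := by
  induction m generalizing i with
  | zero => exact le_rfl
  | succ m ih =>
    exact Finset.sum_nonneg fun w _ => mul_nonneg (abs_nonneg _)
      (add_nonneg (by split_ifs <;> norm_num) (ih w))

/-- The geometric series `ρ + ρ ^ 2 + ⋯`, whose value `q` satisfies `q = ρ (1 + q)`. -/
theorem sum_pathWeight_le {ρ : ℝ} (hρ : ∀ i, ∑ j, |M i j| ≤ ρ) (hρ1 : ρ < 1) (m : ℕ) (i : Fin n) :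
    ∑ j, pathWeight M m i j ≤ ρ / (1 - ρ) := by
  have h0 : 0 ≤ ρ := (Finset.sum_nonneg fun j _ => abs_nonneg _).trans (hρ i)
  have h1 : 0 < 1 - ρ := by linarith
  have hq : 0 ≤ ρ / (1 - ρ) := by positivity
  induction m generalizing i with
  | zero => simpa [pathWeight] using hq
  | succ m ih =>
    simp only [pathWeight]
    rw [Finset.sum_comm]
    simp only [← Finset.mul_sum, Finset.sum_add_distrib]
    calc _ ≤ ∑ w, |M i w| * (1 + ρ / (1 - ρ)) := by
          refine Finset.sum_le_sum fun w _ => mul_le_mul_of_nonneg_left ?_ (abs_nonneg _)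
          simpa using ih w
      _ ≤ ρ * (1 + ρ / (1 - ρ)) := by
          rw [← Finset.sum_mul]
          exact mul_le_mul_of_nonneg_right (hρ i) (by positivity)
      _ = _ := by field_simp; ring

theorem card_pathWeight_le {k : ℕ} (hk : ∀ i, (Finset.univ.filter fun j => M i j ≠ 0).card ≤ k)
    (m : ℕ) (i : Fin n) :
    (Finset.univ.filter fun j => pathWeight M m i j ≠ 0).card ≤ m * (k + 1) ^ m := by
  induction m generalizing i with
  | zero => simp [pathWeight]
  | succ m ih =>
    have hsub : (Finset.univ.filter fun j => pathWeight M (m + 1) i j ≠ 0) ⊆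
        (Finset.univ.filter fun j => M i j ≠ 0).biUnion fun w =>
          insert w (Finset.univ.filter fun j => pathWeight M m w j ≠ 0) := by
      intro j hj
      obtain ⟨w, -, hw⟩ := Finset.exists_ne_zero_of_sum_ne_zero (Finset.mem_filter.1 hj).2
      refine Finset.mem_biUnion.2 ⟨w, ?_, ?_⟩
      · simpa using left_ne_zero_of_mul hw
      · by_contra hne
        simp only [Finset.mem_insert, Finset.mem_filter, Finset.mem_univ, true_and, not_or,
          not_not] at hne
        exact hw (by simp [hne.2, Ne.symm hne.1])
    refine (Finset.card_le_card hsub).trans (Finset.card_biUnion_le.trans ?_)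
    calc _ ≤ ∑ w ∈ Finset.univ.filter fun j => M i j ≠ 0, (m * (k + 1) ^ m + 1) :=
          Finset.sum_le_sum fun w _ => (Finset.card_insert_le _ _).trans
            (Nat.add_le_add_right (ih w) 1)
      _ ≤ k * (m * (k + 1) ^ m + 1) := by
          rw [Finset.sum_const, smul_eq_mul]; exact Nat.mul_le_mul_right _ (hk i)
      _ ≤ _ := by
          have : 1 ≤ (k + 1) ^ m := Nat.one_le_pow _ _ (by omega)
          rw [pow_succ]
          nlinarith

/-- Dobrushin's comparison: two distributions that have the conditional probabilities of the
Ising model outside `A` and that agree on `A` except on `D`. -/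
theorem abs_sum_sub_sum_le (hM0 : ∀ i, M i i = 0) {ρ : ℝ} (hρ : ∀ i, ∑ j, |M i j| ≤ ρ)
    (hρ1 : ρ ≤ 1) {μ ν : (Fin n → Bool) → ℝ} (hμ : ∀ x, 0 ≤ μ x) (hν : ∀ x, 0 ≤ ν x)
    (hμ1 : ∑ x, μ x = 1) (hν1 : ∑ x, ν x = 1) {A D : Finset (Fin n)}
    (hμi : ∀ v, v ∉ A → GlauberInvariant M θ v μ) (hνi : ∀ v, v ∉ A → GlauberInvariant M θ v ν)
    (h : ∀ x y, μ x ≠ 0 → ν y ≠ 0 → ∀ v ∈ A, v ∉ D → x v = y v) (m : ℕ) (i : Fin n) (hi : i ∉ A) :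
    |∑ x, μ x * (if x i then 1 else 0) - ∑ x, ν x * (if x i then 1 else 0)| ≤
      ∑ j ∈ D, pathWeight M m i j + ρ ^ m := by
  classical
  have h0 : 0 ≤ ρ := (Finset.sum_nonneg fun j _ => abs_nonneg _).trans (hρ i)
  -- The trivial estimate: nothing is known outside `A` or on `D`, and the configurations agree on
  -- the rest of `A`.
  set u₀ : Fin n → ℝ := fun v => if v ∈ Aᶜ ∪ D then 1 else 0 with hu₀
  have est0 : IsEstimate μ ν u₀ := isEstimate_of_agree hμ hν hμ1 hν1 _ fun x y hx hy v hv => by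
    simp only [Finset.mem_union, Finset.mem_compl, not_or, not_not] at hv
    exact h x y hx hy v hv.1 hv.2
  have dec0 : ∀ v, improve M A u₀ v ≤ u₀ v := fun v => by
    unfold improve
    split_ifs with hv
    · exact le_rfl
    · calc _ ≤ ∑ w, |M v w| * 1 := Finset.sum_le_sum fun w _ =>
            mul_le_mul_of_nonneg_left (by simp only [hu₀]; split_ifs <;> norm_num) (abs_nonneg _)
        _ ≤ 1 := by simpa using (hρ v).trans hρ1
        _ = u₀ v := by simp [hu₀, hv]
  have iter : ∀ m, IsEstimate μ ν ((improve M A)^[m] u₀) ∧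
      ∀ v, improve M A ((improve M A)^[m] u₀) v ≤ (improve M A)^[m] u₀ v := by
    intro m
    induction m with
    | zero => exact ⟨est0, dec0⟩
    | succ m ih =>
      rw [Function.iterate_succ_apply']
      exact ⟨ih.1.improve hM0 hμi hνi ih.2, improve_mono ih.2⟩
  -- Iterating `improve` follows walks from `v`: those that reach `D` within `m` steps are counted
  -- by `pathWeight`, and `ρ ^ m` accounts for the walks still running. Walks are not stopped in
  -- `A`, which only enlarges the bound.
  have bound : ∀ m v, (improve M A)^[m] u₀ v ≤
      if v ∈ A then (if v ∈ D then 1 else 0) else ∑ j ∈ D, pathWeight M m v j + ρ ^ m := by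
    intro m
    induction m with
    | zero =>
      intro v
      simp only [Function.iterate_zero, id, hu₀, Finset.mem_union, Finset.mem_compl, pathWeight,
        Finset.sum_const_zero, pow_zero, zero_add]
      by_cases hv : v ∈ A <;> simp [hv]
    | succ m ih =>
      intro v
      rw [Function.iterate_succ_apply', improve]
      split_ifs with hv hvD
      · simpa [hv, hvD] using ih v
      · simpa [hv, hvD] using ih v
      calc _ ≤ ∑ w, |M v w| * ((if w ∈ D then 1 else 0) + ∑ j ∈ D, pathWeight M m w j + ρ ^ m) := by
            refine Finset.sum_le_sum fun w _ => mul_le_mul_of_nonneg_left ((ih w).trans ?_)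
              (abs_nonneg _)
            have h1 : 0 ≤ ∑ j ∈ D, pathWeight M m w j :=
              Finset.sum_nonneg fun j _ => pathWeight_nonneg m w j
            have h2 : 0 ≤ ρ ^ m := pow_nonneg h0 m
            split_ifs <;> linarith
        _ = ∑ j ∈ D, pathWeight M (m + 1) v j + ρ ^ m * ∑ w, |M v w| := by
            simp only [pathWeight]
            rw [Finset.sum_comm, Finset.mul_sum, ← Finset.sum_add_distrib]
            refine Finset.sum_congr rfl fun w _ => ?_
            rw [← Finset.mul_sum, Finset.sum_add_distrib, Finset.sum_ite_eq]
            ring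
        _ ≤ _ := by
            rw [pow_succ]
            gcongr
            exact hρ v
  have hosc : Osc (fun x : Fin n → Bool => if x i then (1 : ℝ) else 0)
      fun v => if v = i then 1 else 0 := by
    intro x v s
    by_cases hv : v = i
    · subst hv
      simp only [Function.update_self, if_true]
      cases s <;> cases x v <;> norm_num
    · simp [hv, Function.update_of_ne (Ne.symm hv)]
  refine ((iter m).1 _ _ hosc).trans ?_
  simpa [hi] using bound m i

end Dobrushin

/-! ### Conditional probabilities in the Ising model -/

section Conditional

variable {n : ℕ} (M : Matrix (Fin n) (Fin n) ℝ) (θ : Fin n → ℝ)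

/-- The indicator of the configurations that agree with `y` on `A`. -/
def agree (A : Finset (Fin n)) (y x : Fin n → Bool) : ℝ := if ∀ j ∈ A, x j = y j then 1 else 0

/-- The unnormalised probability of agreeing with `y` on `A`. -/
noncomputable def mass (A : Finset (Fin n)) (y : Fin n → Bool) : ℝ :=
  ∑ x, isingWeight M θ x * agree A y x

/-- The unnormalised probability of agreeing with `y` on `A` and having spin `1` at `i`. -/
noncomputable def massTrue (A : Finset (Fin n)) (y : Fin n → Bool) (i : Fin n) : ℝ :=
  ∑ x, isingWeight M θ x * agree A y x * (if x i then 1 else 0)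

/-- The conditional probability of the spin `1` at `i` given that the configuration agrees with
`y` on `A`. -/
noncomputable def condTrue (A : Finset (Fin n)) (y : Fin n → Bool) (i : Fin n) : ℝ :=
  massTrue M θ A y i / mass M θ A y

variable {M θ}

theorem agree_nonneg (A : Finset (Fin n)) (y x : Fin n → Bool) : 0 ≤ agree A y x := by
  unfold agree; split_ifs <;> norm_num

theorem agree_self (A : Finset (Fin n)) (y : Fin n → Bool) : agree A y y = 1 := if_pos fun _ _ => rfl

theorem agree_congr {A : Finset (Fin n)} {y y' : Fin n → Bool} (h : ∀ j ∈ A, y j = y' j) :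
    agree A y = agree A y' := by
  funext x
  unfold agree
  exact if_congr (forall₂_congr fun j hj => by rw [h j hj]) rfl rfl

theorem mass_congr {A : Finset (Fin n)} {y y' : Fin n → Bool} (h : ∀ j ∈ A, y j = y' j) :
    mass M θ A y = mass M θ A y' := by rw [mass, mass, agree_congr h]

theorem condTrue_congr {A : Finset (Fin n)} {y y' : Fin n → Bool} (h : ∀ j ∈ A, y j = y' j)
    (i : Fin n) : condTrue M θ A y i = condTrue M θ A y' i := by
  rw [condTrue, condTrue, massTrue, massTrue, agree_congr h, mass_congr h]

theorem isingWeight_pos (x : Fin n → Bool) : 0 < isingWeight M θ x := Real.exp_pos _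

theorem mass_pos (A : Finset (Fin n)) (y : Fin n → Bool) : 0 < mass M θ A y :=
  Finset.sum_pos' (fun x _ => mul_nonneg (isingWeight_pos x).le (agree_nonneg A y x))
    ⟨y, Finset.mem_univ y, by rw [agree_self, mul_one]; exact isingWeight_pos y⟩

theorem mass_empty (y : Fin n → Bool) : mass M θ ∅ y = partitionFunction M θ := by
  simp [mass, agree, partitionFunction]

theorem massTrue_nonneg (A : Finset (Fin n)) (y : Fin n → Bool) (i : Fin n) :
    0 ≤ massTrue M θ A y i :=
  Finset.sum_nonneg fun x _ => mul_nonneg (mul_nonneg (isingWeight_pos x).le (agree_nonneg A y x))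
    (by split_ifs <;> norm_num)

theorem massTrue_le (A : Finset (Fin n)) (y : Fin n → Bool) (i : Fin n) :
    massTrue M θ A y i ≤ mass M θ A y :=
  Finset.sum_le_sum fun x _ => mul_le_of_le_one_right
    (mul_nonneg (isingWeight_pos x).le (agree_nonneg A y x)) (by split_ifs <;> norm_num)

theorem condTrue_nonneg (A : Finset (Fin n)) (y : Fin n → Bool) (i : Fin n) :
    0 ≤ condTrue M θ A y i := div_nonneg (massTrue_nonneg A y i) (mass_pos A y).le

theorem condTrue_le_one (A : Finset (Fin n)) (y : Fin n → Bool) (i : Fin n) :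
    condTrue M θ A y i ≤ 1 := (div_le_one (mass_pos A y)).2 (massTrue_le A y i)

theorem condTrue_mul_mass (A : Finset (Fin n)) (y : Fin n → Bool) (i : Fin n) :
    condTrue M θ A y i * mass M θ A y = massTrue M θ A y i :=
  div_mul_cancel₀ _ (mass_pos A y).ne'

theorem agree_insert (A : Finset (Fin n)) (y x : Fin n → Bool) (i : Fin n) :
    agree (insert i A) y x = agree A y x * if x i = y i then 1 else 0 := by
  simp only [agree, Finset.forall_mem_insert]
  split_ifs <;> simp_all

theorem mass_insert (A : Finset (Fin n)) (y : Fin n → Bool) (i : Fin n) :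
    mass M θ (insert i A) y =
      (if y i then condTrue M θ A y i else 1 - condTrue M θ A y i) * mass M θ A y := by
  have e : (if y i then condTrue M θ A y i else 1 - condTrue M θ A y i) * mass M θ A y =
      if y i then massTrue M θ A y i else mass M θ A y - massTrue M θ A y i := by
    split_ifs
    · exact condTrue_mul_mass A y i
    · rw [sub_mul, one_mul, condTrue_mul_mass]
  rw [e, mass]
  simp only [agree_insert, massTrue, mass, ← mul_assoc, ← Finset.sum_sub_distrib]
  cases hy : y i
  · simp only [Bool.false_eq_true, if_false]
    refine Finset.sum_congr rfl fun x _ => ?_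
    cases x i <;> simp
  · simp

theorem glauberInvariant_agree (hM : M.IsSymm) (hM0 : ∀ i, M i i = 0) {A : Finset (Fin n)}
    (y : Fin n → Bool) (c : ℝ) {v : Fin n} (hv : v ∉ A) :
    GlauberInvariant M θ v fun x => isingWeight M θ x * (agree A y x * c) := by
  refine glauberInvariant_isingWeight hM hM0 v _ fun x s => ?_
  congr 1
  refine if_congr (forall₂_congr fun j hj => ?_) rfl rfl
  rw [Function.update_of_ne (by rintro rfl; exact hv hj)]

theorem condTrue_eq_sum (A : Finset (Fin n)) (y : Fin n → Bool) (i : Fin n) :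
    condTrue M θ A y i = ∑ x, isingWeight M θ x * (agree A y x * (mass M θ A y)⁻¹) *
      (if x i then 1 else 0) := by
  rw [condTrue, massTrue, Finset.sum_div]
  refine Finset.sum_congr rfl fun x _ => ?_
  ring

/-- Conditional probabilities given the spins in two subsets of `A` that agree on `A` except
on `D`. -/
theorem abs_condTrue_sub_le (hM : M.IsSymm) (hM0 : ∀ i, M i i = 0) {ρ : ℝ}
    (hρ : ∀ i, ∑ j, |M i j| ≤ ρ) (hρ1 : ρ ≤ 1) {A A₁ A₂ D : Finset (Fin n)} (h₁ : A₁ ⊆ A)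
    (h₂ : A₂ ⊆ A) {y₁ y₂ : Fin n → Bool}
    (h : ∀ v ∈ A, v ∉ D → v ∈ A₁ ∧ v ∈ A₂ ∧ y₁ v = y₂ v) (m : ℕ) {i : Fin n} (hi : i ∉ A) :
    |condTrue M θ A₁ y₁ i - condTrue M θ A₂ y₂ i| ≤ ∑ j ∈ D, pathWeight M m i j + ρ ^ m := by
  have hnn : ∀ B (y : Fin n → Bool) x,
      0 ≤ isingWeight M θ x * (agree B y x * (mass M θ B y)⁻¹) := fun B y x =>
    mul_nonneg (isingWeight_pos x).le (mul_nonneg (agree_nonneg B y x)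
      (inv_nonneg.2 (mass_pos B y).le))
  have h1 : ∀ B (y : Fin n → Bool),
      ∑ x, isingWeight M θ x * (agree B y x * (mass M θ B y)⁻¹) = 1 := fun B y => by
    simp only [← mul_assoc, ← Finset.sum_mul]
    exact mul_inv_cancel₀ (mass_pos B y).ne'
  have hag : ∀ B (y x : Fin n → Bool),
      isingWeight M θ x * (agree B y x * (mass M θ B y)⁻¹) ≠ 0 → ∀ j ∈ B, x j = y j := by
    intro B y x hx
    by_contra hne
    exact hx (by rw [agree, if_neg hne]; simp)
  rw [condTrue_eq_sum, condTrue_eq_sum]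
  -- Vertices of `A` that only one law conditions on belong to `D`, where no agreement is required.
  -- Outside `A` neither law is conditioned, so both are invariant under resampling.
  refine abs_sum_sub_sum_le hM0 hρ hρ1 (hnn A₁ y₁) (hnn A₂ y₂) (h1 A₁ y₁) (h1 A₂ y₂)
    (fun v hv => glauberInvariant_agree hM hM0 _ _ fun hv' => hv (h₁ hv'))
    (fun v hv => glauberInvariant_agree hM hM0 _ _ fun hv' => hv (h₂ hv')) ?_ m i hi
  intro x z hx hz v hv hvD
  obtain ⟨a, b, c⟩ := h v hv hvD
  rw [hag _ _ _ hx v a, hag _ _ _ hz v b, c]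

/-- A lower bound for the probability of either spin given all others. -/
noncomputable def minProb (B : ℝ) : ℝ := Real.sigmoid (-2 * B)

theorem minProb_pos (B : ℝ) : 0 < minProb B := Real.sigmoid_pos _

theorem minProb_le_one (B : ℝ) : minProb B ≤ 1 := Real.sigmoid_le_one _

theorem siteProb_mem {B : ℝ} {v : Fin n} (hB : |θ v| + ∑ w, |M v w| ≤ B) (x : Fin n → Bool) :
    minProb B ≤ siteProb M θ v x ∧ minProb B ≤ 1 - siteProb M θ v x := by
  have : |localField M θ v x| ≤ B := by
    refine (abs_add_le _ _).trans (le_trans ?_ hB)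
    gcongr
    refine (Finset.abs_sum_le_sum_abs _ _).trans (Finset.sum_le_sum fun w _ => ?_)
    rw [abs_mul, abs_spin, mul_one]
  rw [abs_le] at this
  rw [siteProb, ← Real.sigmoid_neg]
  exact ⟨Real.sigmoid_le (by linarith), Real.sigmoid_le (by linarith)⟩

/-- Invariance under resampling at `i` replaces the indicator of the prescribed spin by its
probability given all other spins, which is at least `minProb B` pointwise. -/
theorem minProb_mul_mass_le (hM : M.IsSymm) (hM0 : ∀ i, M i i = 0) {B : ℝ} {i : Fin n}
    (hB : |θ i| + ∑ w, |M i w| ≤ B) {A : Finset (Fin n)} (hi : i ∉ A) (y : Fin n → Bool) :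
    minProb B * mass M θ A y ≤ mass M θ (insert i A) y := by
  have key := glauberInvariant_agree (M := M) (θ := θ) hM hM0 y 1 hi
    (fun x => if x i = y i then 1 else 0)
  simp only [mul_one] at key
  rw [mass, mass]
  simp only [agree_insert, ← mul_assoc]
  rw [key, Finset.mul_sum]
  refine Finset.sum_le_sum fun x _ => ?_
  rw [mul_comm]
  refine mul_le_mul_of_nonneg_left ?_ (mul_nonneg (isingWeight_pos x).le (agree_nonneg A y x))
  have := siteProb_mem hB x
  rw [glauber, Function.update_self, Function.update_self]
  cases y i <;> simp [this]

/-- Events that fix a bounded number of spins have probability bounded below independently of `n`,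
so conditioning on them empirically is affordable. -/
theorem minProb_pow_le_mass (hM : M.IsSymm) (hM0 : ∀ i, M i i = 0) {B : ℝ}
    (hB : ∀ i, |θ i| + ∑ w, |M i w| ≤ B) (A : Finset (Fin n)) (y : Fin n → Bool) :
    minProb B ^ A.card * partitionFunction M θ ≤ mass M θ A y := by
  induction A using Finset.induction_on with
  | empty => simp [mass_empty]
  | insert i A hi ih =>
    rw [Finset.card_insert_of_notMem hi, pow_succ', mul_assoc]
    exact (mul_le_mul_of_nonneg_left ih (minProb_pos B).le).trans
      (minProb_mul_mass_le hM hM0 (hB i) hi y)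

end Conditional

/-! ### Coupling of sequentially sampled configurations -/

section Coupling

/-- The expectation of `φ`. -/
noncomputable def expect {α : Type*} [Fintype α] (γ : PMF α) (φ : α → ℝ) : ℝ :=
  ∑ a, (γ a).toReal * φ a

section Expect

variable {α β : Type*} [Fintype α] [Fintype β]

theorem expect_mono (γ : PMF α) {φ ψ : α → ℝ} (h : ∀ a, φ a ≤ ψ a) : expect γ φ ≤ expect γ ψ :=
  Finset.sum_le_sum fun a _ => mul_le_mul_of_nonneg_left (h a) ENNReal.toReal_nonneg

theorem expect_add (γ : PMF α) (φ ψ : α → ℝ) :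
    expect γ (fun a => φ a + ψ a) = expect γ φ + expect γ ψ := by
  simp [expect, mul_add, Finset.sum_add_distrib]

theorem expect_const_mul (γ : PMF α) (c : ℝ) (φ : α → ℝ) :
    expect γ (fun a => c * φ a) = c * expect γ φ := by
  simp [expect, Finset.mul_sum, mul_left_comm]

theorem expect_sum {ι : Type*} (γ : PMF α) (s : Finset ι) (φ : ι → α → ℝ) :
    expect γ (fun a => ∑ i ∈ s, φ i a) = ∑ i ∈ s, expect γ (φ i) := by
  simp only [expect, Finset.mul_sum]
  exact Finset.sum_comm

theorem expect_const (γ : PMF α) (c : ℝ) : expect γ (fun _ => c) = c := by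
  rw [expect, ← Finset.sum_mul, ← ENNReal.toReal_sum fun a _ => γ.apply_ne_top a,
    ← tsum_fintype (L := .unconditional α), γ.tsum_coe, ENNReal.toReal_one, one_mul]

theorem expect_bind (γ : PMF α) (K : α → PMF β) (φ : β → ℝ) :
    expect (γ.bind K) φ = expect γ fun a => expect (K a) φ := by
  simp only [expect, PMF.bind_apply, tsum_fintype, Finset.mul_sum]
  rw [Finset.sum_comm]
  refine Finset.sum_congr rfl fun b _ => ?_
  rw [ENNReal.toReal_sum fun a _ => ENNReal.mul_ne_top (γ.apply_ne_top a) ((K a).apply_ne_top b),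
    Finset.sum_mul]
  simp [ENNReal.toReal_mul, mul_assoc]

theorem expect_pure (a : α) (φ : α → ℝ) : expect (PMF.pure a) φ = φ a := by
  classical
  rw [expect, Finset.sum_eq_single a]
  · simp
  · intro b _ hb
    simp [PMF.pure_apply, hb]
  · simp

theorem expect_map (γ : PMF α) (g : α → β) (φ : β → ℝ) :
    expect (γ.map g) φ = expect γ fun a => φ (g a) := by
  rw [← PMF.bind_pure_comp, expect_bind]
  simp [expect_pure]

end Expect

/-- The probability of `b` under the Bernoulli distribution. -/
def bernWeight (p : ℝ) (b : Bool) : ℝ := if b then p else 1 - p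

/-- The Bernoulli distribution. -/
noncomputable def bern (p : unitInterval) : PMF Bool :=
  PMF.ofFintype (fun b => ENNReal.ofReal (bernWeight p b)) (by
    rw [Fintype.sum_bool, ← ENNReal.ofReal_add (by simpa [bernWeight] using p.2.1)
      (by simpa [bernWeight] using p.2.2)]
    simp [bernWeight])

def coupleWeight (p q : ℝ) (s : Bool × Bool) : ℝ :=
  match s with
  | (true, true) => min p q
  | (true, false) => p - min p q
  | (false, true) => q - min p q
  | (false, false) => 1 - max p q

theorem coupleWeight_nonneg (p q : unitInterval) (s : Bool × Bool) :
    0 ≤ coupleWeight p q s := by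
  rcases s with ⟨_ | _, _ | _⟩
  · exact sub_nonneg.2 (max_le p.2.2 q.2.2)
  · exact sub_nonneg.2 (min_le_right _ _)
  · exact sub_nonneg.2 (min_le_left _ _)
  · exact le_min p.2.1 q.2.1

theorem max_eq_add_sub_min (p q : ℝ) : max p q = p + q - min p q := by
  linarith [min_add_max p q]

/-- The maximal coupling of two Bernoulli distributions. -/
noncomputable def couple (p q : unitInterval) : PMF (Bool × Bool) :=
  PMF.ofFintype (fun s => ENNReal.ofReal (coupleWeight p q s)) (by
    rw [← ENNReal.ofReal_sum_of_nonneg fun s _ => coupleWeight_nonneg p q s]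
    rw [Fintype.sum_prod_type]
    simp only [Fintype.sum_bool, coupleWeight, max_eq_add_sub_min]
    rw [← ENNReal.ofReal_one]
    congr 1
    ring)

theorem couple_map_fst (p q : unitInterval) : (couple p q).map Prod.fst = bern p := by
  ext b
  rw [PMF.map_apply, tsum_fintype, Fintype.sum_prod_type]
  simp only [Fintype.sum_bool, couple, bern, PMF.ofFintype_apply]
  cases b
  · simp only [Bool.false_eq_true, if_false, if_true, add_zero, zero_add]
    rw [← ENNReal.ofReal_add (coupleWeight_nonneg p q _) (coupleWeight_nonneg p q _)]
    simp only [coupleWeight, bernWeight, max_eq_add_sub_min]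
    congr 1
    rw [if_neg (by simp)]
    ring
  · simp only [Bool.true_eq_false, if_false, if_true, add_zero]
    rw [← ENNReal.ofReal_add (coupleWeight_nonneg p q _) (coupleWeight_nonneg p q _)]
    simp [coupleWeight, bernWeight]

theorem couple_map_snd (p q : unitInterval) : (couple p q).map Prod.snd = bern q := by
  ext b
  rw [PMF.map_apply, tsum_fintype, Fintype.sum_prod_type]
  simp only [Fintype.sum_bool, couple, bern, PMF.ofFintype_apply]
  cases b
  · simp only [Bool.false_eq_true, if_false, if_true, zero_add]
    rw [← ENNReal.ofReal_add (coupleWeight_nonneg p q _) (coupleWeight_nonneg p q _)]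
    simp only [coupleWeight, bernWeight, max_eq_add_sub_min]
    congr 1
    rw [if_neg (by simp)]
    ring
  · simp only [Bool.true_eq_false, if_false, if_true, add_zero]
    rw [← ENNReal.ofReal_add (coupleWeight_nonneg p q _) (coupleWeight_nonneg p q _)]
    simp [coupleWeight, bernWeight]

theorem expect_couple_ne (p q : unitInterval) :
    expect (couple p q) (fun s => if s.1 ≠ s.2 then 1 else 0) = |(p : ℝ) - q| := by
  rw [expect, Fintype.sum_prod_type]
  simp only [Fintype.sum_bool, couple, PMF.ofFintype_apply, coupleWeight]
  rcases le_total (p : ℝ) q with h | h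
  · simp [h, abs_of_nonpos (sub_nonpos.2 h)]
  · simp [h, abs_of_nonneg (sub_nonneg.2 h)]

variable {n : ℕ}

/-- Sample the spin at `t` with probability `f t x` for the spin `1`. -/
noncomputable def seqStep (f : Fin n → (Fin n → Bool) → unitInterval) (t : ℕ) (x : Fin n → Bool) :
    PMF (Fin n → Bool) :=
  if h : t < n then (bern (f ⟨t, h⟩ x)).map (Function.update x ⟨t, h⟩) else PMF.pure x

/-- The law of the configuration after the first `t` spins have been sampled. -/
noncomputable def seqLaw (f : Fin n → (Fin n → Bool) → unitInterval) : ℕ → PMF (Fin n → Bool)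
  | 0 => PMF.pure fun _ => true
  | t + 1 => (seqLaw f t).bind (seqStep f t)

theorem expect_singleton {α : Type*} [Fintype α] [DecidableEq α] (γ : PMF α) (a : α) :
    expect γ (fun b => if b = a then 1 else 0) = (γ a).toReal := by
  simp [expect]

theorem expect_bern (p : unitInterval) (φ : Bool → ℝ) :
    expect (bern p) φ = ∑ b, bernWeight p b * φ b := by
  refine Finset.sum_congr rfl fun b _ => ?_
  rw [bern, PMF.ofFintype_apply, ENNReal.toReal_ofReal]
  cases b
  · simpa [bernWeight] using p.2.2
  · simpa [bernWeight] using p.2.1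

theorem expect_seqStep (f : Fin n → (Fin n → Bool) → unitInterval) {t : ℕ} (h : t < n)
    (x : Fin n → Bool) (φ : (Fin n → Bool) → ℝ) :
    expect (seqStep f t x) φ =
      ∑ b, bernWeight (f ⟨t, h⟩ x) b * φ (Function.update x ⟨t, h⟩ b) := by
  rw [seqStep, dif_pos h, expect_map, expect_bern]

/-- As `f i` sees only earlier coordinates, later steps do not change its value, and the transition
probabilities multiply. Coordinates not yet sampled keep the initial value `true`. -/
theorem seqLaw_apply (f : Fin n → (Fin n → Bool) → unitInterval)
    (hf : ∀ i x y, (∀ j < i, x j = y j) → f i x = f i y) (t : ℕ) (ht : t ≤ n) (x : Fin n → Bool) :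
    (seqLaw f t x).toReal =
      ∏ i : Fin n, if (i : ℕ) < t then bernWeight (f i x) (x i) else if x i then 1 else 0 := by
  induction t generalizing x with
  | zero =>
    simp only [seqLaw, PMF.pure_apply, Nat.not_lt_zero, if_false]
    by_cases hx : x = fun _ => true
    · simp [hx]
    · rw [if_neg hx]
      obtain ⟨i, hi⟩ : ∃ i, x i ≠ true := by
        by_contra hne
        push Not at hne
        exact hx (funext hne)
      rw [Finset.prod_eq_zero (Finset.mem_univ i) (by simp [hi])]
      simp
  | succ t ih =>
    have h : t < n := ht
    set i₀ : Fin n := ⟨t, h⟩ with hi₀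
    rw [← expect_singleton, seqLaw, expect_bind]
    simp only [expect_seqStep f h]
    -- The only predecessor of `x` that can have positive probability: before step `t` the
    -- coordinate `t` is still `true`.
    rw [expect, Finset.sum_eq_single (Function.update x i₀ true)]
    · rw [ih h.le, Finset.sum_eq_single (x i₀)]
      · rw [Function.update_idem, Function.update_eq_self, if_pos rfl, mul_one,
          ← Finset.mul_prod_erase _ _ (Finset.mem_univ i₀),
          ← Finset.mul_prod_erase (a := i₀) _ _ (Finset.mem_univ i₀)]
        rw [if_neg (by simp [hi₀]), Function.update_self, if_pos rfl, one_mul, mul_comm,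
          if_pos (by simp [hi₀])]
        congr 1
        · rw [hf i₀ (Function.update x i₀ true) x fun j hj => Function.update_of_ne hj.ne _ _]
        · refine Finset.prod_congr rfl fun i hi => ?_
          have hne : i ≠ i₀ := Finset.ne_of_mem_erase hi
          have hne' : (i : ℕ) ≠ t := fun e => hne (Fin.ext e)
          rw [Function.update_of_ne hne]
          by_cases hit : (i : ℕ) < t
          · rw [if_pos hit, if_pos (show (i : ℕ) < t + 1 by omega), hf i (Function.update x i₀ true) x fun j hj =>
              Function.update_of_ne (by rintro rfl; exact (lt_asymm hj hit)) _ _]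
          · rw [if_neg hit, if_neg (show ¬ (i : ℕ) < t + 1 by omega)]
      · intro b _ hb
        rw [Function.update_idem, if_neg, mul_zero]
        intro e
        exact hb (by rw [← e, Function.update_self])
      · simp
    · intro y _ hy
      by_cases hyt : y i₀ = true
      · have : ∀ b, Function.update y i₀ b ≠ x := by
          rintro b rfl
          apply hy
          rw [Function.update_idem, ← hyt, Function.update_eq_self]
        simp [← hi₀, this]
      · rw [ih h.le, Finset.prod_eq_zero (Finset.mem_univ i₀) (by simp [hi₀] at hyt ⊢; simp [hyt]), zero_mul]
    · simp

/-- One step of the coupling. -/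
noncomputable def coupleStep (f g : Fin n → (Fin n → Bool) → unitInterval) (t : ℕ)
    (p : (Fin n → Bool) × (Fin n → Bool)) : PMF ((Fin n → Bool) × (Fin n → Bool)) :=
  if h : t < n then (couple (f ⟨t, h⟩ p.1) (g ⟨t, h⟩ p.2)).map fun s =>
    (Function.update p.1 ⟨t, h⟩ s.1, Function.update p.2 ⟨t, h⟩ s.2) else PMF.pure p

/-- The coupling of `seqLaw f` and `seqLaw g` that uses the maximal coupling in each step. -/
noncomputable def seqCouple (f g : Fin n → (Fin n → Bool) → unitInterval) :
    ℕ → PMF ((Fin n → Bool) × (Fin n → Bool))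
  | 0 => PMF.pure (fun _ => true, fun _ => true)
  | t + 1 => (seqCouple f g t).bind (coupleStep f g t)

theorem seqCouple_map_fst (f g : Fin n → (Fin n → Bool) → unitInterval) (t : ℕ) :
    (seqCouple f g t).map Prod.fst = seqLaw f t := by
  induction t with
  | zero => simp [seqCouple, seqLaw, PMF.pure_map]
  | succ t ih =>
    rw [seqCouple, seqLaw, PMF.map_bind, ← ih, PMF.bind_map]
    congr 1
    funext p
    simp only [coupleStep, seqStep, Function.comp]
    split_ifs with h
    · rw [PMF.map_comp, ← couple_map_fst _ (g ⟨t, h⟩ p.2), PMF.map_comp]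
      rfl
    · simp [PMF.pure_map]

theorem seqCouple_map_snd (f g : Fin n → (Fin n → Bool) → unitInterval) (t : ℕ) :
    (seqCouple f g t).map Prod.snd = seqLaw g t := by
  induction t with
  | zero => simp [seqCouple, seqLaw, PMF.pure_map]
  | succ t ih =>
    rw [seqCouple, seqLaw, PMF.map_bind, ← ih, PMF.bind_map]
    congr 1
    funext p
    simp only [coupleStep, seqStep, Function.comp]
    split_ifs with h
    · rw [PMF.map_comp, ← couple_map_snd (f ⟨t, h⟩ p.1) _, PMF.map_comp]
      rfl
    · simp [PMF.pure_map]

/-- The bound `β = η / (1 - α)` solves `β = α β + η`. It holds for all coordinates at the start,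
where the configurations agree, and the maximal coupling preserves it at the coordinate being
sampled, so it does not grow with `t`. -/
theorem expect_seqCouple_ne_le (f g : Fin n → (Fin n → Bool) → unitInterval) {R : Fin n → Fin n → ℝ}
    (hR : ∀ i j, 0 ≤ R i j) {α η : ℝ} (hα : ∀ i, ∑ j, R i j ≤ α) (hα1 : α < 1) (hη : 0 ≤ η)
    (h : ∀ i x y, |(f i x : ℝ) - g i y| ≤ ∑ j, R i j * (if x j ≠ y j then 1 else 0) + η)
    (t : ℕ) (i : Fin n) :
    expect (seqCouple f g t) (fun p => if p.1 i ≠ p.2 i then 1 else 0) ≤ η / (1 - α) := by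
  have h1 : 0 < 1 - α := by linarith
  have hβ : 0 ≤ η / (1 - α) := by positivity
  induction t generalizing i with
  | zero => simpa [seqCouple, expect_pure] using hβ
  | succ t ih =>
    rw [seqCouple, expect_bind]
    by_cases ht : t < n
    · simp only [coupleStep, dif_pos ht, expect_map]
      by_cases hi : i = ⟨t, ht⟩
      · simp only [hi, Function.update_self, expect_couple_ne]
        refine (expect_mono (seqCouple f g t) fun p => h ⟨t, ht⟩ p.1 p.2).trans ?_
        rw [expect_add, expect_const, expect_sum]
        simp only [expect_const_mul]
        calc _ ≤ ∑ j, R ⟨t, ht⟩ j * (η / (1 - α)) + η := by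
              gcongr with j
              · exact hR _ _
              · exact ih j
          _ ≤ α * (η / (1 - α)) + η := by
              rw [← Finset.sum_mul]
              gcongr
              exact hα _
          _ = _ := by field_simp; ring
      · simp only [Function.update_of_ne hi, expect_const]
        exact ih i
    · simp only [coupleStep, dif_neg ht, expect_pure]
      exact ih i

theorem earthMover_le_card {ι : Type*} [Fintype ι] (P Q : Measure (ι → Bool))
    [IsProbabilityMeasure P] [IsProbabilityMeasure Q] : earthMover P Q ≤ Fintype.card ι := by
  refine (iInf₂_le (P.prod Q) (by simp)).trans ((iInf_le _ (by simp)).trans ?_)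
  calc _ ≤ ∫⁻ _, (Fintype.card ι : ℝ≥0∞) ∂(P.prod Q) :=
        lintegral_mono fun p =>
        Nat.cast_le.2 hammingDist_le_card_fintype
    _ = _ := by simp

theorem earthMover_seqLaw_le (f g : Fin n → (Fin n → Bool) → unitInterval) {R : Fin n → Fin n → ℝ}
    (hR : ∀ i j, 0 ≤ R i j) {α η : ℝ} (hα : ∀ i, ∑ j, R i j ≤ α) (hα1 : α < 1) (hη : 0 ≤ η)
    (h : ∀ i x y, |(f i x : ℝ) - g i y| ≤ ∑ j, R i j * (if x j ≠ y j then 1 else 0) + η)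
    (S : Finset (Fin n)) :
    earthMover (((seqLaw f n).map fun x (i : S) => x i).toMeasure)
      (((seqLaw g n).map fun x (i : S) => x i).toMeasure) ≤
      ENNReal.ofReal (n * (η / (1 - α))) := by
  set γ := seqCouple f g n
  set r : (Fin n → Bool) → S → Bool := fun x i => x i
  have hβ : 0 ≤ η / (1 - α) := div_nonneg hη (by linarith)
  refine (iInf₂_le ((γ.map (Prod.map r r)).toMeasure) ?_).trans ((iInf_le _ ?_).trans ?_)
  · rw [PMF.toMeasure_map (hf := .of_discrete), PMF.map_comp, ← seqCouple_map_fst f g, PMF.map_comp]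
    rfl
  · rw [PMF.toMeasure_map (hf := .of_discrete), PMF.map_comp, ← seqCouple_map_snd f g, PMF.map_comp]
    rfl
  · rw [← PMF.toMeasure_map (hf := .of_discrete), lintegral_map (.of_discrete) (.of_discrete),
      lintegral_fintype]
    have e : ∀ p : (Fin n → Bool) × (Fin n → Bool),
        (hammingDist (Prod.map r r p).1 (Prod.map r r p).2 : ℝ≥0∞) * γ.toMeasure {p} ≤
        ENNReal.ofReal ((γ p).toReal * ∑ i, if p.1 i ≠ p.2 i then 1 else 0) := by
      intro p
      rw [PMF.toMeasure_apply_singleton _ _ (measurableSet_singleton p),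
        ENNReal.ofReal_mul ENNReal.toReal_nonneg, ENNReal.ofReal_toReal (γ.apply_ne_top p), mul_comm]
      gcongr
      rw [← ENNReal.ofReal_natCast]
      refine ENNReal.ofReal_le_ofReal ?_
      rw [Finset.sum_boole]
      norm_cast
      refine Finset.card_le_card_of_injOn (fun i : S => (i : Fin n)) ?_
        (fun a _ b _ hab => Subtype.ext hab)
      intro i hi
      simpa [r] using hi
    refine (Finset.sum_le_sum fun p _ => e p).trans ?_
    rw [← ENNReal.ofReal_sum_of_nonneg fun p _ => mul_nonneg ENNReal.toReal_nonneg
      (Finset.sum_nonneg fun i _ => by split_ifs <;> norm_num)]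
    refine ENNReal.ofReal_le_ofReal ?_
    change expect γ _ ≤ _
    rw [expect_sum]
    refine (Finset.sum_le_sum fun i _ => expect_seqCouple_ne_le f g hR hα hα1 hη h n i).trans ?_
    simp

end Coupling

/-! ### The law of the output -/

section OutputLaw

variable {n : ℕ}

/-- The visible vertices before `t`. -/
def vis (S : Finset (Fin n)) (t : ℕ) : Finset (Fin n) := S.filter fun j => (j : ℕ) < t

/-- The visible vertices before `t` that are among `c 0, …, c (len - 1)`. -/
def chosen (S : Finset (Fin n)) (t : ℕ) (c : ℕ → ℕ) (len : ℕ) : Finset (Fin n) :=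
  (vis S t).filter fun j => ∃ l < len, c l = j

/-- Extend a configuration of the visible vertices by the spin `1`. -/
def extend (S : Finset (Fin n)) (z : S → Bool) (j : Fin n) : Bool :=
  if h : j ∈ S then z ⟨j, h⟩ else true

/-- The number of samples that agree with `y` on `C`. -/
def agreeCount (X : ℕ → Fin n → Bool) (N : ℕ) (C : Finset (Fin n)) (y : Fin n → Bool) : ℕ :=
  ((Finset.range N).filter fun m => ∀ j ∈ C, X m j = y j).card

/-- The number of samples that agree with `y` on `C` and have spin `1` at `i`. -/
def agreeCountTrue (X : ℕ → Fin n → Bool) (N : ℕ) (C : Finset (Fin n)) (y : Fin n → Bool)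
    (i : Fin n) : ℕ :=
  ((Finset.range N).filter fun m => (∀ j ∈ C, X m j = y j) ∧ X m i = true).card

/-- Whether the empirical conditional probability of the spin `1` at `i` given the chosen
positions exceeds `u / w`. -/
def exceeds (S : Finset (Fin n)) (X : ℕ → Fin n → Bool) (N len w : ℕ) (i : Fin n)
    (y : Fin n → Bool) (u : ℕ) (c : ℕ → ℕ) : ℕ :=
  if agreeCount X N (chosen S i c len) y * u < agreeCountTrue X N (chosen S i c len) y i * w
  then 1 else 0

/-- The spin that the algorithm chooses at `i`. -/
def decision (S : Finset (Fin n)) (X : ℕ → Fin n → Bool) (N len w : ℕ) (i : Fin n)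
    (y : Fin n → Bool) (u : ℕ) : Bool :=
  decide (gameVal (exceeds S X N len w i y u) n len 0 0 = 1)

theorem gameVal_congr_leaf {leaf leaf' : (ℕ → ℕ) → ℕ} {len : ℕ}
    (h : ∀ c, (∀ l < len, c l < n) → leaf c = leaf' c) (j : ℕ) :
    ∀ l c, l + j = len → (∀ i < l, c i < n) → gameVal leaf n j l c = gameVal leaf' n j l c := by
  induction j with
  | zero => rintro l c rfl hc; exact h c hc
  | succ j ih =>
    intro l c hl hc
    simp only [gameVal]
    refine if_congr (forall₂_congr fun a ha => ?_) rfl rfl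
    rw [ih (l + 1) _ (by omega) fun i hi => ?_]
    by_cases hil : i = l
    · simpa [hil] using ha
    · rw [Function.update_of_ne hil]
      exact hc i (by omega)

theorem decision_congr (S : Finset (Fin n)) (X : ℕ → Fin n → Bool) (N len w : ℕ) (i : Fin n)
    {y y' : Fin n → Bool} (h : ∀ j < i, y j = y' j) (u : ℕ) :
    decision S X N len w i y u = decision S X N len w i y' u := by
  have : exceeds S X N len w i y u = exceeds S X N len w i y' u := by
    funext c
    have hj : ∀ j ∈ chosen S i c len, y j = y' j := fun j hj =>
      h j (Finset.mem_filter.1 (Finset.mem_filter.1 hj).1).2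
    have e : ∀ m, (∀ j ∈ chosen S i c len, X m j = y j) ↔ ∀ j ∈ chosen S i c len, X m j = y' j :=
      fun m => forall₂_congr fun j hjc => by rw [hj j hjc]
    unfold exceeds agreeCount agreeCountTrue
    rw [Finset.filter_congr fun m _ => e m, Finset.filter_congr fun m _ => and_congr_left' (e m)]
  rw [decision, decision, this]

theorem mismSum_eq_zero_iff {x y c : ℕ → ℕ} {len p : ℕ} :
    mismSum x y c len p < 1 ↔ ∀ l < len, mism (x (p + c l)) (y (c l)) = 0 := by
  induction len with
  | zero => simp [mismSum]
  | succ len ih =>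
    rw [Nat.forall_lt_succ_right, ← ih, mismSum]
    omega

theorem stored_sampleTape (S : Finset (Fin n)) (x : ℕ → S → Bool) {N m : ℕ} (hm : m < N)
    (j : Fin n) : stored (sampleTape S x) (N * n) (m * n + j) =
      if j ∈ S then (if extend S (x m) j then 1 else 2) else 0 := by
  have h1 : m * n + j < N * n := by
    have := Nat.mul_le_mul_right n (Nat.succ_le_of_lt hm)
    have := j.2
    rw [Nat.succ_mul] at *
    omega
  have h2 : (m * n + j) % n = j := by rw [Nat.mul_add_mod', Nat.mod_eq_of_lt j.2]
  have h3 : (m * n + j) / n = m := by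
    rw [mul_comm, Nat.mul_add_div (by have := j.2; omega), Nat.div_eq_of_lt j.2, add_zero]
  rw [stored, if_pos h1, sampleTape]
  simp only [h2, h3, j.2, dif_pos, Fin.eta]
  split_ifs with hS <;> simp_all [extend]

/-- The array `Y` encodes the spins of `y` at the visible vertices before `t`. -/
def Encodes (S : Finset (Fin n)) (t : ℕ) (Y : ℕ → ℕ) (y : Fin n → Bool) : Prop :=
  ∀ j : Fin n, (t ≤ j → Y j = 0) ∧ Y j ≤ 2 ∧ (j ∈ vis S t → Y j = if y j then 1 else 2)

theorem leafVal_eq_exceeds (S : Finset (Fin n)) (x : ℕ → S → Bool) (N len w : ℕ) {i : Fin n}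
    (hi : i ∈ S) {Y : ℕ → ℕ} {y : Fin n → Bool} (hY : Encodes S i Y y) (u : ℕ) (c : ℕ → ℕ)
    (hc : ∀ l < len, c l < n) :
    leafVal (stored (sampleTape S x) (N * n)) Y n len i N u w c =
      exceeds S (fun m => extend S (x m)) N len w i y u c := by
  have h1 : ∀ m ∈ Finset.range N, (mismSum (stored (sampleTape S x) (N * n)) Y c len (m * n) < 1 ↔
      ∀ j ∈ chosen S i c len, extend S (x m) j = y j) := by
    intro m hm
    rw [mismSum_eq_zero_iff]
    have key : ∀ j : Fin n, mism (stored (sampleTape S x) (N * n) (m * n + j)) (Y j) = 0 ↔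
        (j ∈ vis S i → extend S (x m) j = y j) := by
      intro j
      rw [stored_sampleTape S x (Finset.mem_range.1 hm)]
      obtain ⟨a, b, d⟩ := hY j
      by_cases hj : j ∈ vis S i
      · rw [d hj, if_pos (Finset.mem_filter.1 hj).1]
        cases extend S (x m) j <;> cases y j <;> simp [mism, hj]
      -- A censored position has symbol `0` in the sample, and a position not yet sampled has `0` in
      -- `Y`; with one symbol `0` the sum is at most `2`, so there is no mismatch.
      · simp only [hj, false_imp_iff, iff_true]
        by_cases hjS : j ∈ S
        · have : (i : ℕ) ≤ j := by
            by_contra hlt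
            exact hj (Finset.mem_filter.2 ⟨hjS, by omega⟩)
          rw [a this]
          unfold mism
          split_ifs <;> rfl
        · rw [if_neg hjS]
          unfold mism
          omega
    constructor
    · intro h j hj
      obtain ⟨hj, l, hl, hcl⟩ := Finset.mem_filter.1 hj
      exact (key j).1 (hcl ▸ h l hl) hj
    · intro h l hl
      exact (key ⟨c l, hc l hl⟩).2 fun hv => h _ (Finset.mem_filter.2 ⟨hv, l, hl, rfl⟩)
  have h2 : ∀ m ∈ Finset.range N, (stored (sampleTape S x) (N * n) (m * n + i) < 2 ↔
      extend S (x m) i = true) := by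
    intro m hm
    rw [stored_sampleTape S x (Finset.mem_range.1 hm), if_pos hi]
    cases extend S (x m) i <;> simp
  rw [leafVal, exceeds, matchCount, matchCountAt, agreeCount, agreeCountTrue,
    Finset.filter_congr h1, Finset.filter_congr fun m hm => and_congr (h1 m hm) (h2 m hm)]

/-- The sampled configuration, with the spin `1` at the censored vertices. -/
def sampledSpins (S : Finset (Fin n)) (x : ℕ → S → Bool) (N len L : ℕ) (coins : ℕ → Bool)
    (j : Fin n) : Bool :=
  if j ∈ S then decide (sampled (stored (sampleTape S x) (N * n)) coins n len N L n j = 1) else true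

theorem sampled_of_lt (x : ℕ → ℕ) (coins : ℕ → Bool) (n len N L : ℕ) {t j : ℕ} (h : j < t) :
    sampled x coins n len N L t j = sampled x coins n len N L (j + 1) j := by
  induction t with
  | zero => omega
  | succ t ih =>
    rcases Nat.lt_succ_iff_lt_or_eq.1 h with h | rfl
    · rw [sampled, Function.update_of_ne h.ne, ih h]
    · rfl

theorem sampled_of_le (x : ℕ → ℕ) (coins : ℕ → Bool) (n len N L : ℕ) {t j : ℕ} (h : t ≤ j) :
    sampled x coins n len N L t j = 0 := by
  induction t with
  | zero => rfl
  | succ t ih => rw [sampled, Function.update_of_ne (by omega), ih (by omega)]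

theorem sampled_self (x : ℕ → ℕ) (coins : ℕ → Bool) (n len N L t : ℕ) :
    sampled x coins n len N L (t + 1) t = 2 - gameVal (leafVal x (sampled x coins n len N L t) n
      len t N (coinWord coins (t * L) L) (2 ^ L)) n len 0 0 := by
  rw [sampled, Function.update_self]

theorem encodes_sampled (S : Finset (Fin n)) (x : ℕ → S → Bool) (N len L : ℕ)
    (coins : ℕ → Bool) (t : ℕ) :
    Encodes S t (sampled (stored (sampleTape S x) (N * n)) coins n len N L t)
      (sampledSpins S x N len L coins) := by
  intro j
  refine ⟨fun h => sampled_of_le _ _ _ _ _ _ h, ?_, fun h => ?_⟩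
  · rcases lt_or_ge (j : ℕ) t with h | h
    · rw [sampled_of_lt _ _ _ _ _ _ h, sampled_self]; omega
    · rw [sampled_of_le _ _ _ _ _ _ h]; omega
  · obtain ⟨hjS, hjt⟩ := Finset.mem_filter.1 h
    rw [sampledSpins, if_pos hjS, sampled_of_lt _ _ _ _ _ _ hjt, sampled_of_lt _ _ _ _ _ _ j.2,
      sampled_self]
    have := gameVal_le_one (n := n) (leafVal_le_one (stored (sampleTape S x) (N * n))
      (sampled (stored (sampleTape S x) (N * n)) coins n len N L j) n len j N
      (coinWord coins (j * L) L) (2 ^ L)) len 0 0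
    interval_cases hg : gameVal (leafVal (stored (sampleTape S x) (N * n))
      (sampled (stored (sampleTape S x) (N * n)) coins n len N L j) n len j N
      (coinWord coins (j * L) L) (2 ^ L)) n len 0 0 <;> simp

theorem sampledSpins_eq (S : Finset (Fin n)) (x : ℕ → S → Bool) (N len L : ℕ)
    (coins : ℕ → Bool) {i : Fin n} (hi : i ∈ S) :
    sampledSpins S x N len L coins i = decision S (fun m => extend S (x m)) N len (2 ^ L) i
      (sampledSpins S x N len L coins) (coinWord coins (i * L) L) := by
  rw [sampledSpins, if_pos hi, sampled_of_lt _ _ _ _ _ _ i.2, sampled_self, decision,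
    gameVal_congr_leaf (fun c hc => leafVal_eq_exceeds S x N len (2 ^ L) hi
      (encodes_sampled S x N len L coins i) _ c hc) len 0 0 (by omega) (by simp)]
  have := gameVal_le_one (n := n) (leaf := exceeds S (fun m => extend S (x m)) N len (2 ^ L) i
    (sampledSpins S x N len L coins) (coinWord coins (i * L) L))
    (fun c => by unfold exceeds; split_ifs <;> simp) len 0 0
  rw [decide_eq_decide]
  exact (by omega : ∀ a : ℕ, a ≤ 1 → (2 - a = 1 ↔ a = 1)) _ this

/-- For a fixed outcome `y` the feedback of earlier spins disappears: each decision can be tested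
against `y` itself, because it sees only earlier spins. The event thus becomes a product of events
about separate blocks of coins. -/
theorem sampledSpins_eq_iff (S : Finset (Fin n)) (x : ℕ → S → Bool) (N len L : ℕ)
    (coins : ℕ → Bool) (y : Fin n → Bool) :
    sampledSpins S x N len L coins = y ↔ ∀ i : Fin n,
      if i ∈ S then decision S (fun m => extend S (x m)) N len (2 ^ L) i y
        (coinWord coins (i * L) L) = y i else y i = true := by
  constructor
  · rintro rfl i
    split_ifs with hi
    · exact (sampledSpins_eq S x N len L coins hi).symm
    · simp [sampledSpins, hi]
  · intro h
    have : ∀ t, ∀ i : Fin n, (i : ℕ) < t → sampledSpins S x N len L coins i = y i := by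
      intro t
      induction t with
      | zero => intro i hi; omega
      | succ t ih =>
        intro i hi
        have hh := h i
        by_cases hiS : i ∈ S
        · rw [if_pos hiS] at hh
          rw [sampledSpins_eq S x N len L coins hiS, ← hh]
          refine decision_congr _ _ _ _ _ _ (fun j hj => ih j ?_) _
          have := Fin.lt_def.1 hj
          omega
        · rw [if_neg hiS] at hh
          simp [sampledSpins, hiS, hh]
    exact funext fun i => this n i i.2

/-! ### Independent uniform thresholds from disjoint blocks of coins. -/

theorem coinWord_lt (coins : ℕ → Bool) (off L : ℕ) : coinWord coins off L < 2 ^ L := by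
  induction L with
  | zero => simp [coinWord]
  | succ L ih => rw [coinWord, pow_succ]; split_ifs <;> omega

theorem coinWord_inj {coins coins' : ℕ → Bool} {off off' L : ℕ} :
    coinWord coins off L = coinWord coins' off' L ↔
      ∀ l < L, coins (off + l) = coins' (off' + l) := by
  induction L with
  | zero => simp [coinWord]
  | succ L ih =>
    rw [Nat.forall_lt_succ_right, ← ih, coinWord, coinWord]
    cases coins (off + L) <;> cases coins' (off' + L) <;> simp <;> omega

/-- The number with the given binary digits. -/
def blockWord {L : ℕ} (s : Fin L → Bool) : ℕ :=
  coinWord (fun k => if h : k < L then s ⟨k, h⟩ else false) 0 L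

theorem blockWord_eq (coins : ℕ → Bool) (off L : ℕ) :
    blockWord (fun l : Fin L => coins (off + l)) = coinWord coins off L := by
  rw [blockWord, coinWord_inj]
  intro l hl
  simp [hl]

theorem blockWord_injective (L : ℕ) : Function.Injective (blockWord (L := L)) := by
  intro s s' h
  rw [blockWord, blockWord, coinWord_inj] at h
  funext l
  simpa using h l l.2

theorem image_blockWord (L : ℕ) :
    (Finset.univ : Finset (Fin L → Bool)).image blockWord = Finset.range (2 ^ L) := by
  refine Finset.eq_of_subset_of_card_le (fun u hu => ?_) ?_
  · obtain ⟨s, -, rfl⟩ := Finset.mem_image.1 hu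
    exact Finset.mem_range.2 (coinWord_lt _ _ _)
  · rw [Finset.card_image_of_injective _ (blockWord_injective L)]
    simp

theorem card_filter_blockWord (L : ℕ) (p : ℕ → Prop) [DecidablePred p] :
    (Finset.univ.filter fun s : Fin L → Bool => p (blockWord s)).card =
      ((Finset.range (2 ^ L)).filter p).card := by
  rw [← image_blockWord, Finset.filter_image,
    Finset.card_image_of_injective _ (blockWord_injective L)]

/-- The coins that are used for the first `n` vertices. -/
def blocks (n L : ℕ) (coins : ℕ → Bool) (i : Fin n) (l : Fin L) : Bool := coins (i * L + l)

theorem measurable_blocks (n L : ℕ) : Measurable (blocks n L) :=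
  measurable_pi_lambda _ fun _ => measurable_pi_lambda _ fun _ => measurable_pi_apply _

theorem measurableSet_blocks {L : ℕ} (V : Fin n → Finset (Fin L → Bool)) :
    MeasurableSet {coins | ∀ i, blocks n L coins i ∈ V i} :=
  measurable_blocks n L (Set.toFinite {s : Fin n → Fin L → Bool | ∀ i, s i ∈ V i}).measurableSet

/-- The blocks use distinct coins, since `(i, l) ↦ i * L + l` is injective, and are therefore
independent. -/
theorem map_blocks (n L : ℕ) : fairCoins.map (blocks n L) =
    Measure.infinitePi fun _ : Fin n => Measure.infinitePi fun _ : Fin L =>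
      (PMF.uniformOfFintype Bool).toMeasure := by
  have hinj : Function.Injective fun p : Fin n × Fin L => (p.1 : ℕ) * L + p.2 := by
    rintro ⟨i, l⟩ ⟨i', l'⟩ h
    have hL : 0 < L := l.pos
    have h1 := congrArg (· / L) h
    have h2 := congrArg (· % L) h
    simp only [Nat.mul_add_mod', Nat.mod_eq_of_lt l.2, Nat.mod_eq_of_lt l'.2] at h2
    simp only [mul_comm _ L, Nat.mul_add_div hL, Nat.div_eq_of_lt l.2, Nat.div_eq_of_lt l'.2,
      add_zero] at h1
    exact Prod.ext (Fin.ext h1) (Fin.ext h2)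
  rw [← Measure.infinitePi_map_curry, ← Measure.map_infinitePi_infinitePi_of_inj
    (P := fun _ : ℕ => (PMF.uniformOfFintype Bool).toMeasure) hinj, Measure.map_map
    (by fun_prop) (by fun_prop)]
  rfl

instance : IsProbabilityMeasure fairCoins := by unfold fairCoins; infer_instance

theorem infinitePi_coins_apply (L : ℕ) (V : Finset (Fin L → Bool)) :
    Measure.infinitePi (fun _ : Fin L => (PMF.uniformOfFintype Bool).toMeasure) (V : Set _) =
      ENNReal.ofReal (V.card / 2 ^ L) := by
  rw [← sum_measure_singleton]
  have : ∀ s ∈ V, Measure.infinitePi (fun _ : Fin L => (PMF.uniformOfFintype Bool).toMeasure) {s} =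
      ENNReal.ofReal (1 / 2 ^ L) := fun s _ => by
    rw [Measure.infinitePi_singleton_of_fintype]
    simp only [PMF.toMeasure_apply_singleton _ _ (measurableSet_singleton _),
      PMF.uniformOfFintype_apply, Fintype.card_bool, Finset.prod_const, Finset.card_univ,
      Fintype.card_fin]
    rw [one_div, ENNReal.ofReal_inv_of_pos (by positivity), ENNReal.ofReal_pow (by norm_num),
      ENNReal.inv_pow]
    simp
  rw [Finset.sum_congr rfl this, Finset.sum_const, nsmul_eq_mul, ← ENNReal.ofReal_natCast,
    ← ENNReal.ofReal_mul (by positivity)]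
  congr 1
  ring

theorem fairCoins_blocks (n L : ℕ) (V : Fin n → Finset (Fin L → Bool)) :
    fairCoins {coins | ∀ i, blocks n L coins i ∈ V i} =
      ENNReal.ofReal (∏ i, ((V i).card / 2 ^ L : ℝ)) := by
  have : {coins | ∀ i, blocks n L coins i ∈ V i} =
      blocks n L ⁻¹' Set.pi (Finset.univ : Finset (Fin n)) fun i => (V i : Set (Fin L → Bool)) := by
    ext; simp
  rw [this, ← Measure.map_apply (measurable_blocks n L)
    (MeasurableSet.pi (Finset.countable_toSet _) fun i _ => (V i).measurableSet), map_blocks,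
    Measure.infinitePi_pi _ fun i _ => (V i).measurableSet,
    ENNReal.ofReal_prod_of_nonneg fun i _ => by positivity]
  exact Finset.prod_congr rfl fun i _ => infinitePi_coins_apply L (V i)

/-- The probability that the algorithm chooses the spin `1` at `i`. -/
noncomputable def decisionProb (S : Finset (Fin n)) (X : ℕ → Fin n → Bool) (N len L : ℕ)
    (i : Fin n) (y : Fin n → Bool) : unitInterval :=
  if i ∈ S then
    ⟨((Finset.range (2 ^ L)).filter fun u => decision S X N len (2 ^ L) i y u = true).card / 2 ^ L,
      by positivity, by
        rw [div_le_one (by positivity)]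
        have := Finset.card_filter_le (Finset.range (2 ^ L))
          fun u => decision S X N len (2 ^ L) i y u = true
        rw [Finset.card_range] at this
        exact_mod_cast this⟩
  else 1

theorem decisionProb_congr (S : Finset (Fin n)) (X : ℕ → Fin n → Bool) (N len L : ℕ) (i : Fin n)
    {y y' : Fin n → Bool} (h : ∀ j < i, y j = y' j) :
    decisionProb S X N len L i y = decisionProb S X N len L i y' := by
  simp only [decisionProb, decision_congr S X N len (2 ^ L) i h]

theorem bernWeight_decisionProb (S : Finset (Fin n)) (X : ℕ → Fin n → Bool) (N len L : ℕ)
    {i : Fin n} (hi : i ∈ S) (y : Fin n → Bool) (b : Bool) :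
    bernWeight (decisionProb S X N len L i y) b = ((Finset.univ.filter fun s : Fin L → Bool =>
      decision S X N len (2 ^ L) i y (blockWord s) = b).card / 2 ^ L : ℝ) := by
  rw [card_filter_blockWord L fun u => decision S X N len (2 ^ L) i y u = b]
  simp only [decisionProb, if_pos hi, bernWeight]
  cases b
  · rw [if_neg (by simp), eq_div_iff (by positivity), sub_mul, div_mul_cancel₀ _ (by positivity)]
    have := Finset.card_filter_add_card_filter_not (s := Finset.range (2 ^ L))
      fun u => decision S X N len (2 ^ L) i y u = true
    simp only [Bool.not_eq_true, Finset.card_range] at this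
    rw [one_mul, sub_eq_iff_eq_add, add_comm]
    exact_mod_cast this.symm
  · rw [if_pos rfl]

theorem sampledSpins_preimage (S : Finset (Fin n)) (x : ℕ → S → Bool) (N len L : ℕ)
    (y : Fin n → Bool) : sampledSpins S x N len L ⁻¹' {y} = {coins | ∀ i, blocks n L coins i ∈
      if i ∈ S then (Finset.univ.filter fun s : Fin L → Bool =>
        decision S (fun m => extend S (x m)) N len (2 ^ L) i y (blockWord s) = y i)
      else if y i = true then Finset.univ else ∅} := by
  ext coins
  rw [Set.mem_preimage, Set.mem_singleton_iff, sampledSpins_eq_iff]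
  refine forall_congr' fun i => ?_
  split_ifs with h1 h2
  · rw [Finset.mem_filter, ← blockWord_eq]
    simp
    rfl
  · simp [h2]
  · simp [h2]

theorem measurable_sampledSpins (S : Finset (Fin n)) (x : ℕ → S → Bool) (N len L : ℕ) :
    Measurable (sampledSpins S x N len L) := by
  refine measurable_to_countable' fun y => ?_
  rw [sampledSpins_preimage]
  exact measurableSet_blocks _

theorem map_sampledSpins (S : Finset (Fin n)) (x : ℕ → S → Bool) (N len L : ℕ) :
    fairCoins.map (sampledSpins S x N len L) =
      (seqLaw (decisionProb S (fun m => extend S (x m)) N len L) n).toMeasure := by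
  refine Measure.ext_of_singleton fun y => ?_
  rw [Measure.map_apply (measurable_sampledSpins S x N len L) (measurableSet_singleton y),
    PMF.toMeasure_apply_singleton _ _ (measurableSet_singleton y), sampledSpins_preimage,
    fairCoins_blocks, ← ENNReal.ofReal_toReal (PMF.apply_ne_top _ y),
    seqLaw_apply _ (fun i y y' h => decisionProb_congr S _ N len L i h) n le_rfl]
  congr 1
  refine Finset.prod_congr rfl fun i _ => ?_
  rw [if_pos i.2]
  by_cases hi : i ∈ S
  · rw [bernWeight_decisionProb S _ N len L hi, if_pos hi]
  · rw [if_neg hi]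
    cases hy : y i <;> simp [decisionProb, hi, bernWeight]

theorem outputLaw_sampler (hn : 0 < n) (q len L : ℕ) (S : Finset (Fin n)) (x : ℕ → S → Bool) :
    outputLaw (sampler q len L) S x =
      ((seqLaw (decisionProb S (fun m => extend S (x m)) (n ^ q) len L) n).map
        fun y (i : S) => y i).toMeasure := by
  rw [← PMF.toMeasure_map (hf := .of_discrete), ← map_sampledSpins, Measure.map_map .of_discrete
    (measurable_sampledSpins S x _ len L), outputLaw]
  congr 1
  funext coins i
  rw [output_sampler hn, Function.comp, sampledSpins, if_pos i.2, pow_succ]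

end OutputLaw

/-! ### The censored Markov random field -/

section Cmrf

variable {n : ℕ} {M : Matrix (Fin n) (Fin n) ℝ} {θ : Fin n → ℝ}

theorem prod_range_div_of_ne_zero {a : ℕ → ℝ} (ha : ∀ t, a t ≠ 0) (k : ℕ) :
    ∏ t ∈ Finset.range k, a (t + 1) / a t = a k / a 0 := by
  induction k with
  | zero => simp [ha]
  | succ k ih => rw [Finset.prod_range_succ, ih, mul_comm, div_mul_div_cancel₀ (ha k)]

theorem ising_apply (x : Fin n → Bool) :
    (ising M θ x).toReal = isingWeight M θ x / partitionFunction M θ := by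
  rw [ising, PMF.ofFintype_apply, ENNReal.toReal_ofReal]
  exact div_nonneg (isingWeight_pos x).le (partitionFunction_pos M θ).le

theorem expect_cmrf (S : Finset (Fin n)) (φ : (S → Bool) → ℝ) :
    expect (cmrf S M θ) φ =
      (∑ x, isingWeight M θ x * φ fun i => x i) / partitionFunction M θ := by
  rw [cmrf, expect_map, expect, Finset.sum_div]
  refine Finset.sum_congr rfl fun x _ => ?_
  rw [ising_apply]
  ring

theorem mass_singleton_extend (S : Finset (Fin n)) (z : S → Bool) :
    (cmrf S M θ z).toReal = mass M θ S (extend S z) / partitionFunction M θ := by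
  rw [← expect_singleton, expect_cmrf, mass]
  congr 1
  refine Finset.sum_congr rfl fun x _ => ?_
  congr 1
  refine if_congr ⟨fun h j hj => ?_, fun h => ?_⟩ rfl rfl
  · rw [extend, dif_pos hj, ← h]
  · funext j
    rw [h j j.2, extend, dif_pos j.2]

theorem vis_succ {S : Finset (Fin n)} (i : Fin n) :
    vis S (i + 1) = if i ∈ S then insert i (vis S i) else vis S i := by
  ext j
  split_ifs with hi
  · simp only [vis, Finset.mem_filter, Finset.mem_insert]
    constructor
    · rintro ⟨h1, h2⟩
      rcases Nat.lt_succ_iff_lt_or_eq.1 h2 with h | h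
      · exact Or.inr ⟨h1, h⟩
      · exact Or.inl (Fin.ext h)
    · rintro (rfl | h)
      · exact ⟨hi, Nat.lt_succ_self _⟩
      · exact ⟨h.1, h.2.trans (Nat.lt_succ_self _)⟩
  · simp only [vis, Finset.mem_filter]
    refine and_congr_right fun h1 => ⟨fun h => ?_, fun h => h.trans (Nat.lt_succ_self _)⟩
    rcases Nat.lt_succ_iff_lt_or_eq.1 h with h | h
    · exact h
    · exact absurd (Fin.ext h ▸ h1) hi

theorem notMem_vis (S : Finset (Fin n)) (i : Fin n) : i ∉ vis S i := by simp [vis]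

/-- The conditional probability of the spin `1` at `i` given the visible vertices before `i`. -/
noncomputable def visProb (S : Finset (Fin n)) (M : Matrix (Fin n) (Fin n) ℝ) (θ : Fin n → ℝ)
    (i : Fin n) (x : Fin n → Bool) : unitInterval :=
  if i ∈ S then ⟨condTrue M θ (vis S i) x i, condTrue_nonneg _ _ _, condTrue_le_one _ _ _⟩ else 1

theorem visProb_congr (S : Finset (Fin n)) (i : Fin n) {x y : Fin n → Bool}
    (h : ∀ j < i, x j = y j) : visProb S M θ i x = visProb S M θ i y := by
  have := condTrue_congr (M := M) (θ := θ) (A := vis S i)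
    (fun j hj => h j (Finset.mem_filter.1 hj).2) i
  simp only [visProb, this]

/-- The chain rule: each factor is a quotient of consecutive masses and the product telescopes. At a
censored vertex the mass does not change and the spin is set to `true`. -/
theorem seqLaw_visProb_apply (S : Finset (Fin n)) (x : Fin n → Bool) :
    (seqLaw (visProb S M θ) n x).toReal =
      if ∀ i, i ∉ S → x i = true then mass M θ S x / partitionFunction M θ else 0 := by
  rw [seqLaw_apply _ (fun i y y' h => visProb_congr S i h) n le_rfl]
  simp only [Fin.is_lt, if_true]
  split_ifs with h
  · have h1 : ∀ i : Fin n, bernWeight (visProb S M θ i x) (x i) =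
        (fun t => mass M θ (vis S (t + 1)) x / mass M θ (vis S t) x) i := by
      intro i
      by_cases hi : i ∈ S
      · simp only [vis_succ, if_pos hi, mass_insert, visProb, bernWeight]
        rw [mul_div_cancel_right₀ _ (mass_pos _ _).ne']
      · simp only [vis_succ, if_neg hi, visProb, bernWeight, h i hi]
        rw [div_self (mass_pos _ _).ne']
        simp
    rw [Finset.prod_congr rfl fun i _ => h1 i, Fin.prod_univ_eq_prod_range
      (fun t => mass M θ (vis S (t + 1)) x / mass M θ (vis S t) x),
      prod_range_div_of_ne_zero fun t => (mass_pos (vis S t) x).ne']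
    rw [show vis S n = S by ext; simp [vis], show vis S 0 = ∅ by ext; simp [vis], mass_empty]
  · push Not at h
    obtain ⟨i, hi, hx⟩ := h
    refine Finset.prod_eq_zero (Finset.mem_univ i) ?_
    simp [visProb, hi, bernWeight, hx]

theorem seqLaw_visProb_map (S : Finset (Fin n)) :
    (seqLaw (visProb S M θ) n).map (fun x (i : S) => x i) = cmrf S M θ := by
  ext z
  rw [← ENNReal.toReal_eq_toReal_iff' (PMF.apply_ne_top _ _) (PMF.apply_ne_top _ _),
    mass_singleton_extend, ← expect_singleton, expect_map, expect,
    Finset.sum_eq_single (extend S z)]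
  · rw [seqLaw_visProb_apply, if_pos fun i hi => by simp [extend, hi], if_pos, mul_one]
    funext i
    simp [extend]
  · intro x _ hx
    rw [seqLaw_visProb_apply]
    split_ifs with h1 h2
    · exfalso
      apply hx
      funext j
      by_cases hj : j ∈ S
      · rw [extend, dif_pos hj, ← h2]
      · rw [extend, dif_neg hj, h1 j hj]
    all_goals simp
  · simp

end Cmrf

/-! ### Empirical frequencies -/

section Empirical

open ProbabilityTheory in
-- Chebyshev's inequality for independent indicators, each of variance at most `1`. This polynomial
-- rate suffices, as the number of samples is a free power of `n`.
theorem frequency_deviation {α : Type*} [Fintype α] [MeasurableSpace α] [DiscreteMeasurableSpace α]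
    (Q : PMF α) (p : α → Prop) [DecidablePred p] {N : ℕ} (hN : 0 < N) {κ : ℝ} (hκ : 0 < κ) :
    Measure.infinitePi (fun _ : ℕ => Q.toMeasure)
      {x | N * κ ≤ |(((Finset.range N).filter fun m => p (x m)).card : ℝ) -
        N * expect Q fun a => if p a then 1 else 0|} ≤ ENNReal.ofReal (1 / (N * κ ^ 2)) := by
  set P := Measure.infinitePi (fun _ : ℕ => Q.toMeasure)
  set φ : α → ℝ := fun a => if p a then 1 else 0 with hφ
  set Y : ℕ → (ℕ → α) → ℝ := fun m x => φ (x m) with hY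
  have hφm : Measurable φ := .of_discrete
  have hYm : ∀ m, Measurable (Y m) := fun m => hφm.comp (measurable_pi_apply m)
  have hφ01 : ∀ a, φ a ∈ Set.Icc (0 : ℝ) 1 := fun a => by
    simp only [hφ]; split_ifs <;> simp
  have hYL : ∀ m, MemLp (Y m) 2 P := fun m =>
    MemLp.of_bound (hYm m).aestronglyMeasurable 1 (Filter.Eventually.of_forall fun x => by
      rw [Real.norm_eq_abs, abs_le]
      have := hφ01 (x m)
      exact ⟨by linarith [this.1], this.2⟩)
  have hind : iIndepFun Y P := iIndepFun_infinitePi (X := fun _ => φ) fun _ => hφm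
  have hmean : ∀ m, ∫ x, Y m x ∂P = expect Q φ := by
    intro m
    have : ∫ x, Y m x ∂P = ∫ a, φ a ∂(P.map fun x => x m) :=
      (integral_map (μ := P) (φ := fun x : ℕ → α => x m) (f := φ)
        (measurable_pi_apply m).aemeasurable hφm.aestronglyMeasurable).symm
    rw [this, Measure.infinitePi_map_eval, PMF.integral_eq_sum]
    simp [expect]
  have hmeanS : ∫ x, (∑ m ∈ Finset.range N, Y m) x ∂P = N * expect Q φ := by
    simp only [Finset.sum_apply]
    rw [integral_finsetSum _ fun m _ => (hYL m).integrable (by norm_num)]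
    simp [hmean]
  have hvar1 : ∀ m, variance (Y m) P ≤ 1 := fun m => by
    have h01 : ∀ᵐ x ∂P, Y m x ∈ Set.Icc (0 : ℝ) 1 :=
      Filter.Eventually.of_forall fun x => hφ01 (x m)
    have := variance_le_sq_of_bounded h01 (hYm m).aemeasurable
    norm_num at this
    linarith
  have hvar : variance (∑ m ∈ Finset.range N, Y m) P ≤ N := by
    rw [IndepFun.variance_sum (fun m _ => hYL m) fun i _ j _ hij => hind.indepFun hij]
    refine (Finset.sum_le_sum fun m _ => hvar1 m).trans ?_
    simp
  have hN' : (0 : ℝ) < N := by exact_mod_cast hN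
  have key := meas_ge_le_variance_div_sq (μ := P) (memLp_finsetSum' (Finset.range N)
    fun m _ => hYL m) (c := N * κ) (by positivity)
  rw [hmeanS] at key
  have hset : {x : ℕ → α | N * κ ≤ |(((Finset.range N).filter fun m => p (x m)).card : ℝ) -
        N * expect Q φ|} = {x | N * κ ≤ |(∑ m ∈ Finset.range N, Y m) x - N * expect Q φ|} := by
    ext x
    simp only [Set.mem_ofPred_eq, Finset.sum_apply, hY, hφ, Finset.sum_boole]
  rw [hset]
  refine key.trans (ENNReal.ofReal_le_ofReal ?_)
  rw [div_le_div_iff₀ (by positivity) (by positivity)]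
  nlinarith [mul_le_mul_of_nonneg_right hvar (by positivity : (0:ℝ) ≤ N * κ ^ 2)]

variable {n : ℕ}

/-- A configuration matches a pattern at the visible vertices among `c`. -/
def Fits {K : ℕ} (S : Finset (Fin n)) (c : Fin K → Fin n) (s : Fin K → Option Bool)
    (z : S → Bool) : Prop := ∀ l, ∀ h : c l ∈ S, ∀ b ∈ s l, z ⟨c l, h⟩ = b

noncomputable instance {K : ℕ} (S : Finset (Fin n)) (c : Fin K → Fin n) (s : Fin K → Option Bool) :
    DecidablePred (Fits S c s) := fun _ => Classical.propDecidable _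

/-- The empirical frequencies of all patterns at `K` vertices are within `κ` of their
probabilities. -/
def Typical (S : Finset (Fin n)) (Q : PMF (S → Bool)) (N K : ℕ) (κ : ℝ) (x : ℕ → S → Bool) :
    Prop := ∀ (c : Fin K → Fin n) (s : Fin K → Option Bool),
  |(((Finset.range N).filter fun m => Fits S c s (x m)).card : ℝ) -
    N * expect Q fun z => if Fits S c s z then 1 else 0| < N * κ

/-- A union bound over the `(3 * n) ^ K` patterns: each slot has a position and either no condition
or one of two spins. -/
theorem not_typical_le (S : Finset (Fin n)) (Q : PMF (S → Bool)) {N : ℕ} (hN : 0 < N) (K : ℕ)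
    {κ : ℝ} (hκ : 0 < κ) : Measure.infinitePi (fun _ : ℕ => Q.toMeasure)
      {x | ¬ Typical S Q N K κ x} ≤ ENNReal.ofReal ((3 * n) ^ K / (N * κ ^ 2)) := by
  have hsub : {x | ¬ Typical S Q N K κ x} ⊆
      ⋃ cs ∈ (Finset.univ : Finset ((Fin K → Fin n) × (Fin K → Option Bool))),
        {x | N * κ ≤ |(((Finset.range N).filter fun m => Fits S cs.1 cs.2 (x m)).card : ℝ) -
          N * expect Q fun z => if Fits S cs.1 cs.2 z then 1 else 0|} := by
    intro x hx
    simp only [Set.mem_ofPred_eq, Typical, not_forall, not_lt] at hx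
    obtain ⟨c, s, h⟩ := hx
    exact Set.mem_biUnion (Finset.mem_coe.2 (Finset.mem_univ (c, s))) h
  refine (measure_mono hsub).trans ((measure_biUnion_finset_le _ _).trans
    ((Finset.sum_le_sum fun cs _ => frequency_deviation Q (Fits S cs.1 cs.2) hN hκ).trans ?_))
  rw [Finset.sum_const, nsmul_eq_mul, ← ENNReal.ofReal_natCast, ← ENNReal.ofReal_mul (by positivity)]
  refine ENNReal.ofReal_le_ofReal (le_of_eq ?_)
  simp only [Finset.card_univ, Fintype.card_prod, Fintype.card_fun, Fintype.card_fin,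
    Fintype.card_option, Fintype.card_bool]
  push_cast
  rw [mul_pow]
  ring

end Empirical

/-! ### The game -/

section Game

theorem gameVal_succ (leaf : (ℕ → ℕ) → ℕ) (n j l : ℕ) (c : ℕ → ℕ) : gameVal leaf n (j + 1) l c =
    if ∀ a < n, gameVal leaf n j (l + 1) (Function.update c l a) = 0 then 1 else 0 := rfl

/-- Two levels of the recursion say that for every first move some second move has value `1`. So the
player for `1` moves second in each pair and the player for `0` moves first. Either has `r` moves
and can use them to name the members of `T` one by one, whatever the opponent does. -/
theorem gameVal_eq_of_forced {leaf : (ℕ → ℕ) → ℕ} {n : ℕ} {v : ℕ}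
    (hv : v ≤ 1) (r : ℕ) : ∀ (l : ℕ) (c : ℕ → ℕ) (T : List ℕ), T.length = r → (∀ a ∈ T, a < n) →
      (∀ i < l, c i < n) → (∀ c', (∀ i < l + 2 * r, c' i < n) → (∀ i < l, c' i = c i) →
        (∀ a ∈ T, ∃ i < l + 2 * r, c' i = a) → leaf c' = v) →
      gameVal leaf n (2 * r) l c = v := by
  induction r with
  | zero =>
    intro l c T hT hTn hc h
    rw [List.length_eq_zero_iff] at hT
    exact h c hc (fun _ _ => rfl) (by simp [hT])
  | succ r ih =>
    intro l c T hT hTn hc h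
    obtain ⟨a, T, rfl⟩ := List.exists_cons_of_length_eq_add_one hT
    have ha : a < n := hTn a (by simp)
    have two : ∀ a₁ < n, ∀ a₂ < n, (a₁ = a ∨ a₂ = a) → gameVal leaf n (2 * r) (l + 1 + 1)
        (Function.update (Function.update c l a₁) (l + 1) a₂) = v := by
      intro a₁ h₁ a₂ h₂ h12
      have e1 : Function.update (Function.update c l a₁) (l + 1) a₂ l = a₁ := by
        rw [Function.update_of_ne (by omega), Function.update_self]
      have e2 : Function.update (Function.update c l a₁) (l + 1) a₂ (l + 1) = a₂ := by
        rw [Function.update_self]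
      have e3 : ∀ i < l, Function.update (Function.update c l a₁) (l + 1) a₂ i = c i := by
        intro i hi
        rw [Function.update_of_ne (by omega), Function.update_of_ne (by omega)]
      refine ih (l + 1 + 1) _ T (by simpa using hT) (fun b hb => hTn b (by simp [hb])) ?_ ?_
      · intro i hi
        rcases Nat.lt_succ_iff_lt_or_eq.1 hi with hi | rfl
        · rcases Nat.lt_succ_iff_lt_or_eq.1 hi with hi | rfl
          · rw [e3 i hi]; exact hc i hi
          · rwa [e1]
        · rwa [e2]
      · intro c' hc'n hc' hT'
        refine h c' (fun i hi => hc'n i (by omega)) (fun i hi => by rw [hc' i (by omega), e3 i hi]) ?_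
        intro b hb
        rcases List.mem_cons.1 hb with rfl | hb
        · rcases h12 with rfl | rfl
          · exact ⟨l, by omega, by rw [hc' l (by omega), e1]⟩
          · exact ⟨l + 1, by omega, by rw [hc' (l + 1) (by omega), e2]⟩
        · obtain ⟨i, hi, hi'⟩ := hT' b hb
          exact ⟨i, by omega, hi'⟩
    rw [show 2 * (r + 1) = 2 * r + 1 + 1 by ring]
    rw [gameVal_succ]
    interval_cases v
    · rw [if_neg]
      intro hall
      have := hall a ha
      rw [gameVal_succ, if_pos fun a₂ h₂ => two a ha a₂ h₂ (Or.inl rfl)] at this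
      exact one_ne_zero this
    · rw [if_pos]
      intro a₁ h₁
      rw [gameVal_succ, if_neg]
      intro hall
      have := hall a ha
      rw [two a₁ h₁ a ha (Or.inr rfl)] at this
      exact one_ne_zero this

end Game

/-! ### Accuracy of the algorithm -/

section Accuracy

variable {n : ℕ} {M : Matrix (Fin n) (Fin n) ℝ} {θ : Fin n → ℝ}

theorem chosen_subset_vis (S : Finset (Fin n)) (t : ℕ) (c : ℕ → ℕ) (len : ℕ) :
    chosen S t c len ⊆ vis S t := Finset.filter_subset _ _

theorem vis_subset (S : Finset (Fin n)) (t : ℕ) : vis S t ⊆ S := Finset.filter_subset _ _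

theorem card_chosen_le (S : Finset (Fin n)) (t : ℕ) (c : ℕ → ℕ) (len : ℕ) :
    (chosen S t c len).card ≤ len := by
  calc _ ≤ ((Finset.range len).image c).card := by
        refine Finset.card_le_card_of_injOn (fun j : Fin n => (j : ℕ)) (fun j hj => ?_)
          (fun a _ b _ h => Fin.ext h)
        obtain ⟨l, hl, h⟩ := (Finset.mem_filter.1 hj).2
        exact Finset.mem_coe.2 (Finset.mem_image.2 ⟨l, Finset.mem_range.2 hl, h⟩)
    _ ≤ len := Finset.card_image_le.trans (by simp)

theorem extend_restrict (S : Finset (Fin n)) (x : Fin n → Bool) {j : Fin n} (hj : j ∈ S) :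
    extend S (fun i : S => x i) j = x j := by rw [extend, dif_pos hj]

/-- Fixing the spins at the chosen positions, and possibly the spin at `i`, is a pattern. -/
theorem fits_chosen (S : Finset (Fin n)) {i : Fin n} (hi : i ∈ S) {c : ℕ → ℕ} {len : ℕ}
    (hc : ∀ l < len, c l < n) (y : Fin n → Bool) (o : Option Bool) :
    ∃ (c' : Fin (len + 1) → Fin n) (s : Fin (len + 1) → Option Bool), ∀ z, Fits S c' s z ↔
      (∀ j ∈ chosen S i c len, extend S z j = y j) ∧ ∀ b ∈ o, extend S z i = b := by
  -- Chosen positions that are censored or not before `i` carry no condition, and the extra last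
  -- slot is for `i` itself.
  refine ⟨fun l => if h : (l : ℕ) < len then ⟨c l, hc l h⟩ else i,
    fun l => if h : (l : ℕ) < len then
      (if (⟨c l, hc l h⟩ : Fin n) ∈ vis S i then some (y ⟨c l, hc l h⟩) else none) else o,
    fun z => ⟨fun h => ⟨fun j hj => ?_, fun b hb => ?_⟩, fun h l hl b hb => ?_⟩⟩
  · obtain ⟨hjv, l, hl, hcl⟩ := Finset.mem_filter.1 hj
    have hjS := vis_subset S i hjv
    obtain rfl : (⟨c l, hc l hl⟩ : Fin n) = j := Fin.ext hcl
    have := h ⟨l, by omega⟩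
    simp only [hl, dif_pos] at this
    rw [extend, dif_pos hjS]
    exact this hjS _ (by rw [if_pos hjv]; rfl)
  · have := h (Fin.last len)
    simp only [Fin.val_last, lt_irrefl, dif_neg, not_false_iff] at this
    rw [extend, dif_pos hi]
    exact this hi b hb
  · by_cases hl' : (l : ℕ) < len
    · simp only [hl', dif_pos] at hl hb ⊢
      split_ifs at hb with hv
      · obtain rfl : y _ = b := Option.some.inj hb
        rw [← h.1 _ (Finset.mem_filter.2 ⟨hv, l, hl', rfl⟩), extend, dif_pos hl]
      · cases hb
    · simp only [hl', dif_neg, not_false_iff] at hl hb ⊢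
      rw [← h.2 b hb, extend, dif_pos hl]

theorem abs_agreeCount_sub_lt {S : Finset (Fin n)} {N len : ℕ} {κ : ℝ} {x : ℕ → S → Bool}
    (hx : Typical S (cmrf S M θ) N (len + 1) κ x) {i : Fin n} (hi : i ∈ S) {c : ℕ → ℕ}
    (hc : ∀ l < len, c l < n) (y : Fin n → Bool) :
    |(agreeCount (fun m => extend S (x m)) N (chosen S i c len) y : ℝ) -
      N * (mass M θ (chosen S i c len) y / partitionFunction M θ)| < N * κ := by
  obtain ⟨c', s, h⟩ := fits_chosen S hi hc y none
  have h' : ∀ z, Fits S c' s z ↔ ∀ j ∈ chosen S i c len, extend S z j = y j := fun z => by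
    rw [h]; simp
  have key := hx c' s
  rw [expect_cmrf, Finset.filter_congr fun m _ => h' (x m)] at key
  have e : mass M θ (chosen S i c len) y =
      ∑ z, isingWeight M θ z * if Fits S c' s (fun i => z i) then 1 else 0 := by
    refine Finset.sum_congr rfl fun z _ => ?_
    congr 1
    rw [agree]
    refine if_congr (Iff.trans (forall₂_congr fun j hj => ?_) (h' _).symm) rfl rfl
    rw [extend_restrict S z (vis_subset S i (chosen_subset_vis _ _ _ _ hj))]
  rwa [e]

theorem abs_agreeCountTrue_sub_lt {S : Finset (Fin n)} {N len : ℕ} {κ : ℝ} {x : ℕ → S → Bool}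
    (hx : Typical S (cmrf S M θ) N (len + 1) κ x) {i : Fin n} (hi : i ∈ S) {c : ℕ → ℕ}
    (hc : ∀ l < len, c l < n) (y : Fin n → Bool) :
    |(agreeCountTrue (fun m => extend S (x m)) N (chosen S i c len) y i : ℝ) -
      N * (massTrue M θ (chosen S i c len) y i / partitionFunction M θ)| < N * κ := by
  obtain ⟨c', s, h⟩ := fits_chosen S hi hc y (some true)
  have h' : ∀ z, Fits S c' s z ↔
      (∀ j ∈ chosen S i c len, extend S z j = y j) ∧ extend S z i = true := fun z => by
    rw [h]; simp
  have key := hx c' s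
  rw [expect_cmrf, Finset.filter_congr fun m _ => h' (x m)] at key
  have e : massTrue M θ (chosen S i c len) y i =
      ∑ z, isingWeight M θ z * if Fits S c' s (fun i => z i) then 1 else 0 := by
    refine Finset.sum_congr rfl fun z _ => ?_
    rw [mul_assoc]
    congr 1
    have e : Fits S c' s (fun i => z i) ↔
        (∀ j ∈ chosen S i c len, z j = y j) ∧ z i = true := by
      rw [h', extend_restrict S z hi]
      refine and_congr_left' (forall₂_congr fun j hj => ?_)
      rw [extend_restrict S z (vis_subset S i (chosen_subset_vis _ _ _ _ hj))]
    rw [agree]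
    by_cases h1 : ∀ j ∈ chosen S i c len, z j = y j <;> by_cases h2 : z i = true
    · rw [if_pos (e.2 ⟨h1, h2⟩), if_pos h1, if_pos h2, mul_one]
    · rw [if_neg fun hf => h2 (e.1 hf).2, if_neg h2, mul_zero]
    · rw [if_neg fun hf => h1 (e.1 hf).1, if_neg h1, zero_mul]
    · rw [if_neg fun hf => h1 (e.1 hf).1, if_neg h1, zero_mul]
  rwa [e]

/-- The constants of the model: the total edge weight at each vertex is at most `ρ`, and the
total strength of the interactions and the bias is at most `B`. -/
structure Bounded (M : Matrix (Fin n) (Fin n) ℝ) (θ : Fin n → ℝ) (ρ B : ℝ) : Prop where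
  symm : M.IsSymm
  diag : ∀ i, M i i = 0
  row : ∀ i, ∑ j, |M i j| ≤ ρ
  total : ∀ i, |θ i| + ∑ j, |M i j| ≤ B

/-- The conditioning event has probability at least `minProb B ^ len`, so both counts are off by at
most `e / 4` times the expected number of matches. The gap between the threshold and the conditional
probability is at least `2 * e - e`, which absorbs both errors. -/
theorem exceeds_eq {ρ B : ℝ} (hM : Bounded M θ ρ B) {S : Finset (Fin n)} {N len w : ℕ}
    (hN : 0 < N) (hw : 0 < w) {e : ℝ} (he : 0 < e) {x : ℕ → S → Bool}
    (hx : Typical S (cmrf S M θ) N (len + 1) (minProb B ^ len * e / 4) x) {i : Fin n} (hi : i ∈ S)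
    {c : ℕ → ℕ} (hc : ∀ l < len, c l < n) (y : Fin n → Bool) {u : ℕ} (hu : u < w) {f : ℝ}
    (hf : |condTrue M θ (chosen S i c len) y i - f| ≤ e) :
    ((u : ℝ) / w ≤ f - 2 * e →
      exceeds S (fun m => extend S (x m)) N len w i y u c = 1) ∧
    (f + 2 * e ≤ (u : ℝ) / w →
      exceeds S (fun m => extend S (x m)) N len w i y u c = 0) := by
  have h1 := abs_agreeCount_sub_lt hx hi hc y
  have h2 := abs_agreeCountTrue_sub_lt hx hi hc y
  have hp := condTrue_mul_mass (M := M) (θ := θ) (chosen S i c len) y i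
  have hZ := partitionFunction_pos M θ
  have hmass : minProb B ^ len ≤ mass M θ (chosen S i c len) y / partitionFunction M θ := by
    rw [le_div_iff₀ hZ]
    refine le_trans ?_ (minProb_pow_le_mass hM.symm hM.diag hM.total (chosen S i c len) y)
    refine mul_le_mul_of_nonneg_right ?_ hZ.le
    exact pow_le_pow_of_le_one (minProb_pos B).le (minProb_le_one B) (card_chosen_le S i c len)
  have hδ : 0 < minProb B ^ len := pow_pos (minProb_pos B) _
  have hT : massTrue M θ (chosen S i c len) y i / partitionFunction M θ =
      condTrue M θ (chosen S i c len) y i *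
        (mass M θ (chosen S i c len) y / partitionFunction M θ) := by
    rw [← hp]; ring
  rw [hT] at h2
  set p := condTrue M θ (chosen S i c len) y i
  set a := mass M θ (chosen S i c len) y / partitionFunction M θ
  set A := agreeCount (fun m => extend S (x m)) N (chosen S i c len) y with hA
  set A' := agreeCountTrue (fun m => extend S (x m)) N (chosen S i c len) y i with hA'
  have hN' : (0 : ℝ) < N := by exact_mod_cast hN
  have hw' : (0 : ℝ) < w := by exact_mod_cast hw
  have hu' : (u : ℝ) / w ≤ 1 := by
    rw [div_le_one hw']; exact_mod_cast hu.le
  have hu0 : 0 ≤ (u : ℝ) / w := by positivity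
  have hiff : A * u < A' * w ↔ (A : ℝ) * (u / w) < A' := by
    rw [← mul_div_assoc, div_lt_iff₀ hw']
    exact_mod_cast Iff.rfl
  rw [exceeds, ← hA, ← hA']
  rw [abs_lt] at h1 h2
  rw [abs_le] at hf
  set t := (u : ℝ) / w
  have hNa : (N : ℝ) * (minProb B ^ len * e / 4) ≤ N * a * e / 4 := by
    have : (N : ℝ) * (minProb B ^ len * e / 4) ≤ N * (a * e / 4) := by gcongr
    linarith
  have hNae : 0 < N * a * e := by
    have : 0 < a := hδ.trans_le hmass
    positivity
  have hNa0 : 0 ≤ (N : ℝ) * a := mul_nonneg hN'.le (hδ.le.trans hmass)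
  constructor
  · intro ht
    rw [if_pos]
    rw [hiff]
    have k1 : (A : ℝ) * t ≤ (N * a + N * a * e / 4) * t := by
      refine mul_le_mul_of_nonneg_right ?_ hu0
      linarith
    have k2 : N * a * e / 4 * t ≤ N * a * e / 4 := mul_le_of_le_one_right (by linarith) hu'
    have k3 : N * a * t ≤ N * a * (p - e) := mul_le_mul_of_nonneg_left (by linarith) hNa0
    nlinarith
  · intro ht
    rw [if_neg]
    rw [hiff, not_lt]
    have k1 : (N * a - N * a * e / 4) * t ≤ (A : ℝ) * t := by
      refine mul_le_mul_of_nonneg_right ?_ hu0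
      linarith
    have k2 : N * a * e / 4 * t ≤ N * a * e / 4 := mul_le_of_le_one_right (by linarith) hu'
    have k3 : N * a * (p + e) ≤ N * a * t := mul_le_mul_of_nonneg_left (by linarith) hNa0
    nlinarith

/-- The two conditionings differ only at visible vertices that were not chosen. These have zero walk
weight by `hc`, so only the tail `ρ ^ m` remains. -/
theorem abs_condTrue_chosen_sub_le {ρ B : ℝ} (hM : Bounded M θ ρ B) (hρ : ρ ≤ 1)
    (S : Finset (Fin n)) (i : Fin n) {c : ℕ → ℕ} {len m : ℕ}
    (hc : ∀ j ∈ vis S i, pathWeight M m i j ≠ 0 → ∃ l < len, c l = j) (y : Fin n → Bool) :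
    |condTrue M θ (chosen S i c len) y i - condTrue M θ (vis S i) y i| ≤ ρ ^ m := by
  refine (abs_condTrue_sub_le hM.symm hM.diag hM.row hρ (A := vis S i)
    (D := vis S i \ chosen S i c len) (chosen_subset_vis S i c len) subset_rfl
    (fun v hv hvD => ⟨?_, hv, rfl⟩) m (notMem_vis S i)).trans ?_
  · by_contra hne
    exact hvD (Finset.mem_sdiff.2 ⟨hv, hne⟩)
  · rw [Finset.sum_eq_zero, zero_add]
    intro j hj
    obtain ⟨hjv, hjc⟩ := Finset.mem_sdiff.1 hj
    by_contra hne
    exact hjc (Finset.mem_filter.2 ⟨hjv, hc j hjv hne⟩)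

theorem decision_eq {ρ B : ℝ} (hM : Bounded M θ ρ B) (hρ : ρ ≤ 1) {S : Finset (Fin n)}
    {N r w m : ℕ} (hN : 0 < N) (hw : 0 < w) {e : ℝ} (he : 0 < e) (hm : ρ ^ m ≤ e)
    {x : ℕ → S → Bool}
    (hx : Typical S (cmrf S M θ) N (2 * r + 1) (minProb B ^ (2 * r) * e / 4) x) {i : Fin n}
    (hi : i ∈ S) (hr : (Finset.univ.filter fun j => pathWeight M m i j ≠ 0).card ≤ r)
    (y : Fin n → Bool) {u : ℕ} (hu : u < w) :
    ((u : ℝ) / w ≤ condTrue M θ (vis S i) y i - 2 * e →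
      decision S (fun m => extend S (x m)) N (2 * r) w i y u = true) ∧
    (condTrue M θ (vis S i) y i + 2 * e ≤ (u : ℝ) / w →
      decision S (fun m => extend S (x m)) N (2 * r) w i y u = false) := by
  set F := Finset.univ.filter fun j => pathWeight M m i j ≠ 0
  -- Padding with `i` makes the length exactly `r`. This move is legal and adds no condition, since
  -- `i` is not in `vis S i`.
  set T : List ℕ := (F.toList.map fun j : Fin n => (j : ℕ)) ++ List.replicate (r - F.card) (i : ℕ)
  have hT : T.length = r := by
    simp only [T, List.length_append, List.length_map, Finset.length_toList, List.length_replicate]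
    omega
  have hTn : ∀ a ∈ T, a < n := by
    intro a ha
    rcases List.mem_append.1 ha with ha | ha
    · obtain ⟨j, -, rfl⟩ := List.mem_map.1 ha
      exact j.2
    · rw [List.eq_of_mem_replicate ha]
      exact i.2
  have hFT : ∀ j, pathWeight M m i j ≠ 0 → (j : ℕ) ∈ T := fun j hj =>
    List.mem_append_left _ (List.mem_map.2 ⟨j, by simpa [F] using hj, rfl⟩)
  have key : ∀ v ≤ 1, (∀ c : ℕ → ℕ, (∀ l < 2 * r, c l < n) →
      |condTrue M θ (chosen S i c (2 * r)) y i - condTrue M θ (vis S i) y i| ≤ e →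
      exceeds S (fun m => extend S (x m)) N (2 * r) w i y u c = v) →
      gameVal (exceeds S (fun m => extend S (x m)) N (2 * r) w i y u) n (2 * r) 0 0 = v := by
    intro v hv h
    refine gameVal_eq_of_forced hv r 0 0 T hT hTn (by simp) fun c hc _ hcT => ?_
    rw [zero_add] at hc hcT
    exact h c hc ((abs_condTrue_chosen_sub_le hM hρ S i
      (fun j _ hj => hcT j (hFT j hj)) y).trans hm)
  constructor
  · intro hle
    rw [decision, key 1 le_rfl fun c hc hcc =>
      (exceeds_eq hM hN hw he hx hi hc y hu hcc).1 hle]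
    rfl
  · intro hle
    rw [decision, key 0 zero_le_one fun c hc hcc =>
      (exceeds_eq hM hN hw he hx hi hc y hu hcc).2 hle]
    rfl

/-- Only thresholds within `2 * e` of `f` are undetermined; rounding to integers costs a further `1
/ W`, which is at most `e`. -/
theorem abs_card_filter_sub_le {W : ℕ} (hW : 0 < W) {p : ℕ → Prop} [DecidablePred p] {f e : ℝ}
    (hf0 : 0 ≤ f) (hf1 : f ≤ 1) (he : 0 < e) (hWe : 1 / (W : ℝ) ≤ e)
    (h1 : ∀ u < W, (u : ℝ) / W ≤ f - 2 * e → p u) (h0 : ∀ u < W, f + 2 * e ≤ (u : ℝ) / W → ¬ p u) :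
    |f - ((Finset.range W).filter p).card / W| ≤ 3 * e := by
  have hW' : (0 : ℝ) < W := by exact_mod_cast hW
  rw [div_le_iff₀ hW'] at hWe
  have lower : (W : ℝ) * (f - 2 * e) ≤ ((Finset.range W).filter p).card := by
    refine (Nat.le_ceil _).trans (Nat.cast_le.2 ?_)
    rw [← Finset.card_range ⌈(W : ℝ) * (f - 2 * e)⌉₊]
    refine Finset.card_le_card fun u hu => ?_
    have hu' := Nat.lt_ceil.1 (Finset.mem_range.1 hu)
    have huW : u < W := by
      have : (u : ℝ) < W := hu'.trans_le (mul_le_of_le_one_right hW'.le (by linarith))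
      exact_mod_cast this
    refine Finset.mem_filter.2 ⟨Finset.mem_range.2 huW, h1 u huW ?_⟩
    rw [div_le_iff₀ hW']
    linarith
  have upper : (((Finset.range W).filter p).card : ℝ) ≤ W * (f + 2 * e) + 1 := by
    refine le_trans (Nat.cast_le.2 ?_) (Nat.ceil_lt_add_one (by positivity)).le
    rw [← Finset.card_range ⌈(W : ℝ) * (f + 2 * e)⌉₊]
    refine Finset.card_le_card fun u hu => ?_
    obtain ⟨huW, hpu⟩ := Finset.mem_filter.1 hu
    rw [Finset.mem_range, Nat.lt_ceil]
    by_contra hlt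
    refine h0 u (Finset.mem_range.1 huW) ?_ hpu
    rw [le_div_iff₀ hW']
    linarith
  rw [abs_le]
  constructor
  · rw [neg_le, neg_sub, sub_le_iff_le_add, div_le_iff₀ hW']
    nlinarith
  · rw [sub_le_comm, le_div_iff₀ hW']
    nlinarith

/-- The hypothesis of the coupling bound. Of the error `4 * e`, one `e` pays for cutting walks at
length `m` when `z` is replaced by `y`, and `3 * e` for the game with a random threshold. -/
theorem abs_visProb_sub_decisionProb_le {ρ B : ℝ} (hM : Bounded M θ ρ B) (hρ : ρ ≤ 1)
    {S : Finset (Fin n)} {N r L m : ℕ} (hN : 0 < N) {e : ℝ} (he : 0 < e) (hm : ρ ^ m ≤ e)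
    (hL : (1 / 2 : ℝ) ^ L ≤ e) {x : ℕ → S → Bool}
    (hx : Typical S (cmrf S M θ) N (2 * r + 1) (minProb B ^ (2 * r) * e / 4) x)
    (hr : ∀ i, (Finset.univ.filter fun j => pathWeight M m i j ≠ 0).card ≤ r) (i : Fin n)
    (z y : Fin n → Bool) :
    |(visProb S M θ i z : ℝ) - decisionProb S (fun m => extend S (x m)) N (2 * r) L i y| ≤
      ∑ j, pathWeight M m i j * (if z j ≠ y j then 1 else 0) + 4 * e := by
  have hnn : 0 ≤ ∑ j, pathWeight M m i j * (if z j ≠ y j then 1 else 0) :=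
    Finset.sum_nonneg fun j _ => mul_nonneg (pathWeight_nonneg m i j) (by split_ifs <;> norm_num)
  by_cases hi : i ∈ S
  · simp only [visProb, decisionProb, if_pos hi]
    have k1 : |condTrue M θ (vis S i) z i - condTrue M θ (vis S i) y i| ≤
        ∑ j, pathWeight M m i j * (if z j ≠ y j then 1 else 0) + e := by
      refine (abs_condTrue_sub_le hM.symm hM.diag hM.row hρ subset_rfl subset_rfl
        (D := Finset.univ.filter fun j => z j ≠ y j)
        (fun v hv hvD => ⟨hv, hv, ?_⟩) m (notMem_vis S i)).trans ?_
      · by_contra hne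
        exact hvD (Finset.mem_filter.2 ⟨Finset.mem_univ v, hne⟩)
      · rw [Finset.sum_filter]
        simp only [mul_ite, mul_one, mul_zero]
        linarith
    have k2 := abs_card_filter_sub_le (W := 2 ^ L) (by positivity)
      (p := fun u => decision S (fun m => extend S (x m)) N (2 * r) (2 ^ L) i y u = true)
      (condTrue_nonneg (M := M) (θ := θ) (vis S i) y i) (condTrue_le_one _ _ _) he
      (by simpa using hL)
      (fun u hu => (decision_eq hM hρ hN (by positivity) he hm hx hi (hr i) y hu).1)
      (fun u hu h => by
        rw [(decision_eq hM hρ hN (by positivity) he hm hx hi (hr i) y hu).2 h]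
        simp)
    push_cast at k2
    calc _ ≤ _ := abs_sub_le _ (condTrue M θ (vis S i) y i) _
      _ ≤ _ := by linarith
  · simp only [visProb, decisionProb, if_neg hi, sub_self, abs_zero]
    positivity

/-- With `n ^ (2 * r + 2)` samples the probability of atypical samples is `O(1 / n)`; multiplied by
the trivial distance bound `n`, it leaves the constant second term. -/
theorem learningError_sampler_le (hn : 0 < n) {ρ B : ℝ} (hM : Bounded M θ ρ B) (hρ : ρ < 1 / 2)
    (S : Finset (Fin n)) {r L m : ℕ} {e : ℝ} (he : 0 < e) (hm : ρ ^ m ≤ e)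
    (hL : (1 / 2 : ℝ) ^ L ≤ e)
    (hr : ∀ i, (Finset.univ.filter fun j => pathWeight M m i j ≠ 0).card ≤ r) :
    learningError (sampler (2 * r + 2) (2 * r) L) S (cmrf S M θ) ≤
      ENNReal.ofReal (n * (4 * e / (1 - ρ / (1 - ρ))) +
        3 ^ (2 * r + 1) / (minProb B ^ (2 * r) * e / 4) ^ 2) := by
  have hρ0 : 0 ≤ ρ := (Finset.sum_nonneg fun j _ => abs_nonneg _).trans (hM.row ⟨0, hn⟩)
  have hα : ρ / (1 - ρ) < 1 := by rw [div_lt_one (by linarith)]; linarith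
  set κ := minProb B ^ (2 * r) * e / 4
  have hκ : 0 < κ := by have := pow_pos (minProb_pos B) (2 * r); positivity
  set N := n ^ (2 * r + 2)
  have hN : 0 < N := pow_pos hn _
  set P := Measure.infinitePi (fun _ : ℕ => (cmrf S M θ).toMeasure)
  set bad := {x : ℕ → S → Bool | ¬ Typical S (cmrf S M θ) N (2 * r + 1) κ x}
  set W := ENNReal.ofReal (n * (4 * e / (1 - ρ / (1 - ρ))))
  have hpt : ∀ x, earthMover (cmrf S M θ).toMeasure
      (outputLaw (sampler (2 * r + 2) (2 * r) L) S x) ≤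
      W + bad.indicator (fun _ => (n : ℝ≥0∞)) x := by
    intro x
    rw [outputLaw_sampler hn]
    by_cases hx : Typical S (cmrf S M θ) N (2 * r + 1) κ x
    · refine le_trans ?_ le_self_add
      rw [← seqLaw_visProb_map]
      exact earthMover_seqLaw_le _ _ (fun i j => pathWeight_nonneg m i j)
        (fun i => sum_pathWeight_le hM.row (by linarith) m i) hα (by positivity)
        (abs_visProb_sub_decisionProb_le hM (by linarith) hN he hm hL hx hr) S
    · rw [Set.indicator_of_mem (show x ∈ bad from hx)]
      refine le_trans (earthMover_le_card _ _) (le_trans ?_ le_add_self)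
      rw [Fintype.card_coe]
      exact_mod_cast (Finset.card_le_univ S).trans (by simp)
  calc learningError (sampler (2 * r + 2) (2 * r) L) S (cmrf S M θ)
      ≤ ∫⁻ x, (W + bad.indicator (fun _ => (n : ℝ≥0∞)) x) ∂P := lintegral_mono hpt
    _ = W + ∫⁻ x, bad.indicator (fun _ => (n : ℝ≥0∞)) x ∂P := by
        rw [lintegral_add_left measurable_const]; simp
    _ ≤ W + n * ENNReal.ofReal ((3 * n) ^ (2 * r + 1) / (N * κ ^ 2)) := by
        gcongr
        exact (lintegral_indicator_const_le _ _).trans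
          (mul_le_mul_right (not_typical_le S _ hN _ hκ) _)
    _ = _ := by
        rw [← ENNReal.ofReal_natCast n, ← ENNReal.ofReal_mul (by positivity),
          ← ENNReal.ofReal_add (mul_nonneg (by positivity)
            (div_nonneg (by positivity) (by linarith))) (by positivity)]
        congr 2
        have hn' : (n : ℝ) ≠ 0 := by exact_mod_cast hn.ne'
        simp only [N]
        push_cast
        field_simp
        ring

end Accuracy

end CensoredIsing

open CensoredIsing in
theorem mainTheorem1 (ε b d : ℝ) (hε : 0 < ε) (hb : 0 < b) (hd : 0 < d) (hbd : b * d < 1 / 2) :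
    ∃ (c K : ℕ) (C : ℝ) (A : CensoredIsing.Prog), 0 < c ∧ 0 < C ∧
      ∀ (n : ℕ), 0 < n → ∀ (S : Finset (Fin n)) (θ : Fin n → ℝ) (M : Matrix (Fin n) (Fin n) ℝ),
        (∀ i, θ i ∈ Set.Icc (-b) b) →
        M.IsSymm →
        (∀ i, M i i = 0) →
        (∀ i j, |M i j| ≤ b) →
        (∀ i, (Set.ncard {j | M i j ≠ 0} : ℝ) ≤ d) →
          CensoredIsing.RunsInTime A S (K * n ^ c) ∧
          CensoredIsing.learningError A S (CensoredIsing.cmrf S M θ) ≤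
            ENNReal.ofReal (ε * n + C) := by
  set ρ := b * d with hρdef
  have hρ0 : 0 < ρ := by positivity
  have hα : 0 < 1 - ρ / (1 - ρ) := by
    rw [sub_pos, div_lt_one (by linarith)]; linarith
  -- Chosen so that the error `4 * e / (1 - ρ / (1 - ρ))` per vertex equals `ε`.
  set e := ε * (1 - ρ / (1 - ρ)) / 4 with hedef
  have he : 0 < e := by positivity
  obtain ⟨m, hm⟩ := exists_pow_lt_of_lt_one he (show ρ < 1 by linarith)
  obtain ⟨L, hL⟩ := exists_pow_lt_of_lt_one he (show (1 / 2 : ℝ) < 1 by norm_num)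
  -- The bound of `card_pathWeight_le` for the number of relevant vertices when each vertex has at
  -- most `⌊d⌋₊` neighbours.
  set r := m * (⌊d⌋₊ + 1) ^ m with hrdef
  -- `b + ρ` bounds the bias plus the total edge weight at each vertex.
  have hδ := minProb_pos (b + ρ)
  refine ⟨2 * r + 2 + 2 * r + 1, 4 * L + 6 * (2 * r + 2) + 12 * (2 * r) + 60,
    3 ^ (2 * r + 1) / (minProb (b + ρ) ^ (2 * r) * e / 4) ^ 2,
    sampler (2 * r + 2) (2 * r) L, by omega, by positivity, ?_⟩
  intro n hn S θ M hθ hM hM0 hMb hMd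
  have hcard : ∀ i, ((Finset.univ.filter fun j => M i j ≠ 0).card : ℝ) ≤ d := fun i => by
    have := hMd i
    rwa [Set.ncard_eq_toFinset_card', Set.toFinset_ofPred] at this
  have hrow : ∀ i, ∑ j, |M i j| ≤ ρ := fun i => by
    rw [← Finset.sum_filter_of_ne (p := fun j => M i j ≠ 0) fun j _ hj => by
      simpa using hj]
    calc _ ≤ ∑ j ∈ Finset.univ.filter fun j => M i j ≠ 0, b := Finset.sum_le_sum fun j _ => hMb i j
      _ ≤ _ := by
        rw [Finset.sum_const, nsmul_eq_mul, hρdef, mul_comm b]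
        exact mul_le_mul_of_nonneg_right (hcard i) hb.le
  refine ⟨sampler_halts hn _ _ _ S, ?_⟩
  have key := learningError_sampler_le hn (ρ := ρ) (B := b + ρ) (M := M) (θ := θ)
    ⟨hM, hM0, hrow, fun i => add_le_add (abs_le.2 (hθ i)) (hrow i)⟩ hbd S (r := r) he hm.le hL.le
    (fun i => card_pathWeight_le (fun i => Nat.le_floor (hcard i)) m i)
  have h4 : 4 * e / (1 - ρ / (1 - ρ)) = ε := by
    rw [hedef]
    field_simp
  rwa [h4, mul_comm (n : ℝ) ε] at key
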